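/- Let $d\in\{2,3\}$, $\ell>0$, $0<R\le \ell/4$, and let $v_{\mathbb R^d}\ge 0$ be a radial potential on $\mathbb R^d$ with support in the closed ball of radius $R$ and scattering length $a>0$. The scattering length is determined by $E_2(v,\widetilde R)=2\pi/\log(\widetilde R/a)$, $E_3(v,\widetilde R)=4\pi a/(1-a/\widetilde R)$ for all $\widetilde R>R$, where $E_d(v,\widetilde R)$ is the infimum of $\int_{B(0,\widetilde R)}(|\nabla\varphi|^2+\frac12 v_{\mathbb R^d}\varphi^2)$ over $\varphi\in H^1(B(0,\widetilde R))$ with $\varphi=1$ on $\partial B(0,\widetilde R)$. Let $\varphi^0$ be the continuous radial scattering solution: $-\Delta\varphi^0+\frac12 v_{\mathbb R^d}\varphi^0=0$ in the sense of distributions on $\mathbb R^d$, and, for $|x|\ge R$, $\varphi^0(x)=\log(|x|/a)$ if $d=2$, $\varphi^0(x)=1-a/|x|$ if $d=3$. Put $\varphi=2\delta\varphi^0$ if $d=2$, where $\delta>0$ is such that $\widetilde R=ae^{1/(2\delta)}>R$, and $\varphi=\varphi^0$ if $d=3$; further $\omega_{\mathbb R^d}=1-\varphi$ and $g_{\mathbb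 R^d}=v_{\mathbb R^d}(1-\omega_{\mathbb R^d})$. Let $\Lambda=[-\ell/2,\ell/2]^d$ with periodic boundary conditions, $|\Lambda|=\ell^d$, $\Lambda^*=\frac{2\pi}{\ell}\mathbb Z^d$, $x^*=\min_{z\in\mathbb Z^d}|x-z\ell|$, and let $v(x)=v_{\mathbb R^d}(x^*)$, $g(x)=g_{\mathbb R^d}(x^*)$, $\omega(x)=\omega_{\mathbb R^d}(x^*)$ be the periodic versions; assume $v\in L^2(\Lambda)$. Write $\widehat f(k)=\int_\Lambda f(x)e^{-ikx}\,dx$. For $N\ge 0$ let $$\mathcal H_N=\sum_{j=1}^N-\Delta_j+\sum_{1\le i<j\le N}v(x_i-x_j)$$ act on $L^2_{\rm sym}(\Lambda^N)$, with domain the $\Psi$ for which both the kinetic term (in the sense of distributions on the torus) and the potential term applied to $\Psi$ lie in $L^2$. Let $P=|\Lambda|^{-1}|1\rangle\langle 1|$, $Q=1-P$, let $P_j,Q_j$ be these projections acting on the variable $x_j$, and set $n_0=\sum_jP_j$, $n_+=\sum_jQ_j$, $$\mathcal Q_3^{\rm ren}=\sum_{i\ne j}P_iQ_j\,g(x_i-x_j)\,Q_jQ_i+h.c.,$$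 $$\mathcal Q_4^{\rm ren}=\tfrac12\sum_{i\neq j}\big[Q_iQ_j+(P_iP_j+P_iQ_j+Q_iP_j)\omega(x_i-x_j)\big]v(x_i-x_j)\big[Q_jQ_i+\omega(x_i-x_j)(P_jP_i+P_jQ_i+Q_jP_i)\big].$$ Let $a_k^\dagger=|\Lambda|^{-1/2}a^\dagger(e^{ikx})$ and $a_k=|\Lambda|^{-1/2}a(e^{ikx})$, $k\in\Lambda^*$, be the bosonic creation and annihilation operators of plane waves on Fock space. Then, on the domain of $\mathcal H_N$, \begin{align*} \mathcal H_N&=\sum_{k\in\Lambda^*}k^2a_k^\dagger a_k+\frac1{2|\Lambda|}\big(\widehat g(0)+\widehat{g\omega}(0)\big)a_0^\dagger a_0^\dagger a_0a_0\\ &\quad+\frac1{|\Lambda|}\sum_{k\in\Lambda^*,\,k\ne0}\Big(\big(\widehat g(k)+\widehat{g\omega}(k)\big)a_0^\dagger a_k^\dagger a_ka_0+\frac12\widehat g(k)\big(a_0^\dagger a_0^\dagger a_ka_{-k}+h.c.\big)\Big)\\ &\quad+\big(\widehat g(0)+\widehat{g\omega}(0)\big)\frac{n_0n_+}{|\Lambda|}+\mathcal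 Q_3^{\rm ren}+\mathcal Q_4^{\rm ren}, \end{align*} where, applied to any $\Psi$ in the domain of $\mathcal H_N$, every term is in $L^2(\Lambda^N)$ and both sums over $k$ converge unconditionally in $L^2(\Lambda^N)$. -/

import Mathlib

open MeasureTheory Filter Topology
open scoped ENNReal

noncomputable section

namespace DiluteBose

/-! ### Scattering length and scattering solution on `ℝ^d`

Radial functions on `ℝ^d` are given by their profile `r ↦ V r`, i.e. `V_{ℝ^d}(x) = V ‖x‖`. -/

/-- `G` is the distributional gradient of `φ` on `ℝ^d` (both locally integrable). -/
def IsWeakGradient (d : ℕ) (φ : EuclideanSpace ℝ (Fin d) → ℝ)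
    (G : EuclideanSpace ℝ (Fin d) → EuclideanSpace ℝ (Fin d)) : Prop :=
  LocallyIntegrable φ volume ∧ LocallyIntegrable G volume ∧
    ∀ u : EuclideanSpace ℝ (Fin d) → ℝ, ContDiff ℝ ((⊤ : ℕ∞) : WithTop ℕ∞) u → HasCompactSupport u →
      ∀ α : Fin d,
        ∫ x, φ x * fderiv ℝ u x (EuclideanSpace.single α 1) = - ∫ x, G x α * u x

/-- `E_d(v, R̃)`: the infimum of `∫_{B(0,R̃)} |∇φ|² + ½ v φ²` over `φ ∈ H¹(B(0,R̃))` with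
boundary value `1`. The boundary condition is expressed by extending `φ` by the constant `1`
outside the ball and requiring the extension to be weakly differentiable on `ℝ^d`. -/
def scatteringEnergy (d : ℕ) (V : ℝ → ℝ) (Rt : ℝ) : ℝ≥0∞ :=
  ⨅ (φ : EuclideanSpace ℝ (Fin d) → ℝ)
    (G : EuclideanSpace ℝ (Fin d) → EuclideanSpace ℝ (Fin d))
    (_ : IsWeakGradient d φ G) (_ : ∀ x, Rt ≤ ‖x‖ → φ x = 1),
    ∫⁻ x in Metric.ball 0 Rt, ENNReal.ofReal (‖G x‖ ^ 2 + (1 / 2) * V ‖x‖ * φ x ^ 2)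

/-- `a > 0` is the scattering length (for `d = 2, 3`) of the potential with profile `V` supported
in the ball of radius `R`: `E_2(v,R̃) = 2π / log(R̃/a)`, `E_3(v,R̃) = 4πa / (1 - a/R̃)`. -/
def IsScatteringLength (d : ℕ) (V : ℝ → ℝ) (R a : ℝ) : Prop :=
  0 < a ∧ ∀ Rt : ℝ, R < Rt →
    scatteringEnergy d V Rt =
      ENNReal.ofReal (if d = 2 then 2 * Real.pi / Real.log (Rt / a)
        else 4 * Real.pi * a / (1 - a / Rt))

/-- `φ₀` is the (profile of the continuous representative of the) scattering solution
`φ⁰_{ℝ^d}`, `d = 2, 3`: it solves `-Δφ⁰ + ½ v φ⁰ = 0` in the sense of distributions on `ℝ^d`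
and has the explicit form `log(|x|/a)`, resp. `1 - a/|x|`, for `|x| ≥ R`. -/
structure IsScatteringSolution (d : ℕ) (V : ℝ → ℝ) (R a : ℝ) (φ₀ : ℝ → ℝ) : Prop where
  continuous : Continuous fun x : EuclideanSpace ℝ (Fin d) => φ₀ ‖x‖
  equation : ∀ u : EuclideanSpace ℝ (Fin d) → ℝ, ContDiff ℝ ((⊤ : ℕ∞) : WithTop ℕ∞) u → HasCompactSupport u →
    ∫ x, (φ₀ ‖x‖ * (-Laplacian.laplacian u x) + (1 / 2) * V ‖x‖ * φ₀ ‖x‖ * u x) = 0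
  outside : ∀ r : ℝ, R ≤ r → φ₀ r = if d = 2 then Real.log (r / a) else 1 - a / r

/-- The normalized scattering solution `φ_{ℝ^d}`: `φ_{ℝ²} = 2δ φ⁰_{ℝ²}`, which equals `1` at
`R̃ = a e^{1/(2δ)}`, and `φ_{ℝ³} = φ⁰_{ℝ³}`. -/
def scatteringNormalized (d : ℕ) (δ : ℝ) (φ₀ : ℝ → ℝ) (r : ℝ) : ℝ :=
  if d = 2 then 2 * δ * φ₀ r else φ₀ r

/-- `ω_{ℝ^d} = 1 - φ_{ℝ^d}`. -/
def omegaProfile (d : ℕ) (δ : ℝ) (φ₀ : ℝ → ℝ) (r : ℝ) : ℝ :=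
  1 - scatteringNormalized d δ φ₀ r

/-- `g_{ℝ^d} = v_{ℝ^d} (1 - ω_{ℝ^d})`. -/
def gProfile (d : ℕ) (V : ℝ → ℝ) (δ : ℝ) (φ₀ : ℝ → ℝ) (r : ℝ) : ℝ :=
  V r * (1 - omegaProfile d δ φ₀ r)

/-! ### The torus -/

/-- The torus of unit cell `Λ = [-ℓ/2, ℓ/2]^d`, with total volume `ℓ^d`. -/
abbrev Torus (d : ℕ) (ℓ : ℝ) : Type := Fin d → AddCircle ℓ

/-- `x* = min_{z ∈ ℤ^d} |x - zℓ|`. (The norm of `AddCircle ℓ` is the distance to the nearest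
point of `ℤℓ`, and the Euclidean minimum is attained coordinatewise.) -/
def torusNorm {d : ℕ} {ℓ : ℝ} (x : Torus d ℓ) : ℝ := Real.sqrt (∑ α, ‖x α‖ ^ 2)

/-- The periodic version `x ↦ f(x*)` of a radial function with profile `f`. -/
def periodize (d : ℕ) (ℓ : ℝ) (f : ℝ → ℝ) (x : Torus d ℓ) : ℝ := f (torusNorm x)

/-- The plane wave `e^{ikx}`, `k = 2πn/ℓ ∈ Λ^*`. Momenta are indexed by `n ∈ ℤ^d`. -/
def planeWave {d : ℕ} {ℓ : ℝ} (n : Fin d → ℤ) (x : Torus d ℓ) : ℂ := ∏ α, fourier (n α) (x α)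

/-- `k² = |2πn/ℓ|²`. -/
def momentumSq {d : ℕ} (ℓ : ℝ) (n : Fin d → ℤ) : ℝ := ∑ α, (2 * Real.pi * n α / ℓ) ^ 2

variable {d : ℕ} {ℓ : ℝ} [Fact (0 < ℓ)]

/-- `f̂(k) = ∫_Λ f(x) e^{-ikx} dx`. -/
def fourierHat (f : Torus d ℓ → ℝ) (n : Fin d → ℤ) : ℂ :=
  ∫ x, (f x : ℂ) * planeWave (-n) x

/-! ### `N`-particle wave functions

Elements of `L²(Λ^N)` are represented by functions `Λ^N → ℂ`; equality in `L²` is equality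
almost everywhere. -/

/-- `N`-particle wave functions. -/
abbrev WaveFn (d : ℕ) (ℓ : ℝ) (N : ℕ) : Type := (Fin N → Torus d ℓ) → ℂ

/-- `Ψ ∈ L²_sym(Λ^N)`. -/
def IsBosonic {N : ℕ} (Ψ : WaveFn d ℓ N) : Prop :=
  MemLp Ψ 2 volume ∧ ∀ σ : Equiv.Perm (Fin N), (fun x => Ψ (x ∘ σ)) =ᵐ[volume] Ψ

/-- Smooth functions on the torus `Λ^N`: the lift to `ℝ^{dN}` is smooth. -/
def IsSmooth {N : ℕ} (u : WaveFn d ℓ N) : Prop :=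
  ContDiff ℝ ((⊤ : ℕ∞) : WithTop ℕ∞) fun y : Fin N → Fin d → ℝ => u fun j α => (y j α : AddCircle ℓ)

/-- The Laplacian `Δ_j` of a smooth function on the torus `Λ^N`, in the variable `x_j`. -/
def smoothLaplacian {N : ℕ} (j : Fin N) (u : WaveFn d ℓ N) : WaveFn d ℓ N := fun x =>
  ∑ α : Fin d, iteratedDeriv 2
    (fun t : ℝ => u (x + Pi.single j (Pi.single α (t : AddCircle ℓ)))) 0

/-- `∑_j -Δ_j Ψ = T` for the periodic Laplacian, in the sense of distributions on the torus. -/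
def IsKineticImage {N : ℕ} (Ψ T : WaveFn d ℓ N) : Prop :=
  ∀ u : WaveFn d ℓ N, IsSmooth u →
    ∫ x, Ψ x * (∑ j, -smoothLaplacian j u x) = ∫ x, T x * u x

/-- Multiplication by `f(x_i - x_j)`. -/
def mulPair {N : ℕ} (f : Torus d ℓ → ℝ) (i j : Fin N) (Ψ : WaveFn d ℓ N) : WaveFn d ℓ N :=
  fun x => (f (x i - x j) : ℂ) * Ψ x

/-- Multiplication by `∑_{i<j} v(x_i - x_j)`. -/
def potentialEnergy {N : ℕ} (v : Torus d ℓ → ℝ) (Ψ : WaveFn d ℓ N) : WaveFn d ℓ N :=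
  ∑ i, ∑ j ∈ Finset.univ.filter (fun j => i < j), mulPair v i j Ψ

/-- The graph of `H_N = ∑_j -Δ_j + ∑_{i<j} v(x_i - x_j)` on `L²_sym(Λ^N)`: `Ψ` lies in the domain
(those `Ψ ∈ L²_sym` for which the kinetic and the potential energy of `Ψ` lie in `L²`) and
`H_N Ψ = Φ`. -/
def HamiltonianGraph {N : ℕ} (v : Torus d ℓ → ℝ) (Ψ Φ : WaveFn d ℓ N) : Prop :=
  IsBosonic Ψ ∧ MemLp (potentialEnergy v Ψ) 2 volume ∧
    ∃ T : WaveFn d ℓ N, MemLp T 2 volume ∧ IsKineticImage Ψ T ∧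
      Φ =ᵐ[volume] T + potentialEnergy v Ψ

/-- `P_j`, the projection `P = |Λ|⁻¹ |1⟩⟨1|` acting on the variable `x_j`. -/
def projP {N : ℕ} (j : Fin N) (Ψ : WaveFn d ℓ N) : WaveFn d ℓ N := fun x =>
  ((ℓ ^ d : ℝ) : ℂ)⁻¹ * ∫ y : Torus d ℓ, Ψ (Function.update x j y)

/-- `Q_j = 1 - P_j`. -/
def projQ {N : ℕ} (j : Fin N) (Ψ : WaveFn d ℓ N) : WaveFn d ℓ N := Ψ - projP j Ψ

/-- `n_0 = ∑_j P_j`. -/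
def numZero {N : ℕ} (Ψ : WaveFn d ℓ N) : WaveFn d ℓ N := ∑ j, projP j Ψ

/-- `n_+ = ∑_j Q_j`. -/
def numPlus {N : ℕ} (Ψ : WaveFn d ℓ N) : WaveFn d ℓ N := ∑ j, projQ j Ψ

/-- `Q_3^ren = ∑_{i≠j} P_i Q_j g(x_i-x_j) Q_j Q_i + h.c.` -/
def Q3ren {N : ℕ} (g : Torus d ℓ → ℝ) (Ψ : WaveFn d ℓ N) : WaveFn d ℓ N :=
  ∑ i, ∑ j ∈ Finset.univ.filter (fun j => i ≠ j),
    (projP i (projQ j (mulPair g i j (projQ j (projQ i Ψ)))) +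
      projQ i (projQ j (mulPair g i j (projQ j (projP i Ψ)))))

/-- `P_i P_j + P_i Q_j + Q_i P_j`. -/
def projPair {N : ℕ} (i j : Fin N) (Ψ : WaveFn d ℓ N) : WaveFn d ℓ N :=
  projP i (projP j Ψ) + projP i (projQ j Ψ) + projQ i (projP j Ψ)

/-- `Q_4^ren = ½ ∑_{i≠j} [Q_iQ_j + (P_iP_j + P_iQ_j + Q_iP_j) ω(x_i-x_j)] v(x_i-x_j)
[Q_jQ_i + ω(x_i-x_j) (P_jP_i + P_jQ_i + Q_jP_i)]`. -/
def Q4ren {N : ℕ} (v ω : Torus d ℓ → ℝ) (Ψ : WaveFn d ℓ N) : WaveFn d ℓ N :=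
  (1 / 2 : ℂ) • ∑ i, ∑ j ∈ Finset.univ.filter (fun j => i ≠ j),
    let Θ : WaveFn d ℓ N :=
      mulPair v i j (projQ j (projQ i Ψ) + mulPair ω i j (projPair j i Ψ))
    projQ i (projQ j Θ) + projPair i j (mulPair ω i j Θ)

/-! ### Second quantization -/

/-- Sequences `(Ψ_n)_n` of `n`-particle wave functions; the bosonic Fock space consists of those
with `Ψ_n ∈ L²_sym(Λ^n)` and `∑_n ‖Ψ_n‖² < ∞`. -/
abbrev FockFn (d : ℕ) (ℓ : ℝ) : Type := ∀ n : ℕ, WaveFn d ℓ n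

/-- `a_k = |Λ|^{-1/2} a(e^{ikx})`, where
`(a(f)Ψ)_n(x_1,…,x_n) = √(n+1) ∫ conj (f(y)) Ψ_{n+1}(y, x_1,…,x_n) dy`. -/
def ann (k : Fin d → ℤ) (Ψ : FockFn d ℓ) : FockFn d ℓ := fun n x =>
  (Real.sqrt (n + 1) : ℂ) * ((Real.sqrt (ℓ ^ d))⁻¹ : ℂ) *
    ∫ y : Torus d ℓ, starRingEnd ℂ (planeWave k y) * Ψ (n + 1) (Fin.cons y x)

/-- `a_k† = |Λ|^{-1/2} a†(e^{ikx})`, where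
`(a†(f)Ψ)_{n+1}(x_0,…,x_n) = (n+1)^{-1/2} ∑_j f(x_j) Ψ_n(x_0,…,x̂_j,…,x_n)`. -/
def cre (k : Fin d → ℤ) (Ψ : FockFn d ℓ) : FockFn d ℓ
  | 0 => 0
  | n + 1 => fun x => ((Real.sqrt (n + 1))⁻¹ : ℂ) * ((Real.sqrt (ℓ ^ d))⁻¹ : ℂ) *
      ∑ j : Fin (n + 1), planeWave k (x j) * Ψ n (fun i => x (j.succAbove i))

/-- The action on an `N`-particle wave function of a particle-number preserving operator on Fock
space. -/
def onSector (A : FockFn d ℓ → FockFn d ℓ) {N : ℕ} (Ψ : WaveFn d ℓ N) : WaveFn d ℓ N :=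
  A (Pi.single N Ψ) N

/-- `k² a_k† a_k`. -/
def kineticTerm (k : Fin d → ℤ) (Ψ : FockFn d ℓ) : FockFn d ℓ :=
  (momentumSq ℓ k : ℂ) • cre k (ann k Ψ)

/-- `a_0† a_0† a_0 a_0`. -/
def condensateTerm (Ψ : FockFn d ℓ) : FockFn d ℓ := cre 0 (cre 0 (ann 0 (ann 0 Ψ)))

/-- `(ĝ(k) + (gω)^(k)) a_0† a_k† a_k a_0 + ½ ĝ(k) (a_0† a_0† a_k a_{-k} + h.c.)`. -/
def pairTerm (g ω : Torus d ℓ → ℝ) (k : Fin d → ℤ) (Ψ : FockFn d ℓ) : FockFn d ℓ :=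
  (fourierHat g k + fourierHat (g * ω) k) • cre 0 (cre k (ann k (ann 0 Ψ))) +
    (1 / 2 * fourierHat g k) •
      (cre 0 (cre 0 (ann k (ann (-k) Ψ))) + cre (-k) (cre k (ann 0 (ann 0 Ψ))))

/-- The family `f` is (unconditionally) summable in `L²(Λ^N)` with sum `S`. -/
def HasSumL2 {ι : Type} {N : ℕ} (f : ι → WaveFn d ℓ N) (S : WaveFn d ℓ N) : Prop :=
  (∀ k, MemLp (f k) 2 volume) ∧ MemLp S 2 volume ∧
    Tendsto (fun s : Finset ι => eLpNorm ((∑ k ∈ s, f k) - S) 2 volume) atTop (𝓝 0)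

end DiluteBose

end

noncomputable section

namespace DiluteBose

/-! ### Character families and Fourier bases -/

/-! Fix a pair i ≠ j and put Π = P_iP_j + P_iQ_j + Q_iP_j, so that 1 = Q_iQ_j + Π. Since v(1 - ω) =
g, the right factor of the square in 𝒬₄ satisfies v(Q_jQ_i + ωΠ) = v - gΠ, and the left factor is 1
- Π(1 - ω). Expanding the product gives v = [Q_iQ_j + Πω] v [Q_jQ_i + ωΠ] + Π g Q_jQ_i + Q_iQ_j g Π
+ Π(g + gω)Π, which is the algebraic core (`pair_decomposition`). In the two cross terms the P_iP_j
part of Π annihilates or creates a pair of momenta ±k, and the mixed part gives 𝒬₃. In the last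
term, momentum conservation in the form P_i f(x_i - x_j) P_i = |Λ|⁻¹ f̂(0) P_i leaves multiples of
P_iP_j, P_iQ_j, Q_iP_j and two exchange terms. Half the sum over ordered pairs gives the stated
coefficients.

As v may be unbounded, the identity is applied to vectors. Because v ≥ 0, each v(x_i - x_j)Ψ is
dominated by the total potential energy and lies in L² (`memLp_mulPair`). For f ∈ L²(Λ) the operator
f(x_i - x_j)P_i is bounded, since P_iΨ does not depend on x_i (`lintegral_pair_mul_sq`, `pairOp`).
Hence gΠΨ is in L², and so is g Q_jQ_iΨ = (1 - ω)vΨ - gΠΨ, as ω is continuous on a compact torus.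

For the momentum sums, f ↦ f(x_i - x_j)P_i is continuous and linear from L²(Λ) to bounded operators,
so the unconditionally convergent Fourier series of f passes through it. For f a plane wave, the
projected operators are identified on the plane waves of Λ^N, whose span is dense
(`config_clm_ext`). Bosonic symmetry turns monomials in a_k, a_k† into sums of rank-one operators
acting on single coordinates (`represents_cre_cre_ann_ann`). The kinetic sum follows from Parseval
and dominated convergence (`hasSum_kinetic`). -/

/-- A family of continuous characters that is closed under multiplication and conjugation,
separates points, and whose nontrivial members have integral zero. -/
structure IsCharacterFamily {κ X : Type*} [AddCommGroup κ] [TopologicalSpace X] [MeasureSpace X]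
    (e : κ → X → ℂ) : Prop where
  continuous : ∀ p, Continuous (e p)
  map_zero : ∀ x, e 0 x = 1
  map_add : ∀ p q x, e (p + q) x = e p x * e q x
  map_neg : ∀ p x, e (-p) x = starRingEnd ℂ (e p x)
  integral_eq_zero : ∀ p, p ≠ 0 → ∫ x, e p x = 0
  separates : ∀ x y, (∀ p, e p x = e p y) → x = y

namespace IsCharacterFamily

section General

variable {κ X : Type*} [AddCommGroup κ] [TopologicalSpace X] [MeasureSpace X] {e : κ → X → ℂ}

/-- The members of a character family as continuous maps. -/
def toC (he : IsCharacterFamily e) (p : κ) : C(X, ℂ) := ⟨e p, he.continuous p⟩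

variable [CompactSpace X]

/-- The star subalgebra spanned by a character family. -/
def subalgebra (he : IsCharacterFamily e) : StarSubalgebra ℂ C(X, ℂ) where
  toSubalgebra := Algebra.adjoin ℂ (Set.range he.toC)
  star_mem' := by
    change Algebra.adjoin ℂ (Set.range he.toC) ≤ star (Algebra.adjoin ℂ (Set.range he.toC))
    refine Algebra.adjoin_le ?_
    rintro _ ⟨n, rfl⟩
    refine Algebra.subset_adjoin ⟨-n, ?_⟩
    ext1 x
    exact he.map_neg n x

/-- Products of characters are characters, so the generated algebra is no larger than the linear
span. -/
lemma subalgebra_coe (he : IsCharacterFamily e) :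
    Subalgebra.toSubmodule he.subalgebra.toSubalgebra = Submodule.span ℂ (Set.range he.toC) := by
  apply Algebra.adjoin_eq_span_of_subset
  refine .trans (fun x ↦ Submonoid.closure_induction (fun _ ↦ id) ⟨0, ?_⟩ ?_)
    Submodule.subset_span
  · ext z
    exact he.map_zero z
  · rintro _ _ _ _ ⟨m, rfl⟩ ⟨n, rfl⟩
    refine ⟨m + n, ?_⟩
    ext z
    exact he.map_add m n z

/-- Stone–Weierstrass for the point-separating star subalgebra of trigonometric polynomials. -/
lemma span_closure_eq_top (he : IsCharacterFamily e) :
    (Submodule.span ℂ (Set.range he.toC)).topologicalClosure = ⊤ := by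
  have hsep : he.subalgebra.SeparatesPoints := by
    intro x y hxy
    by_contra hcon
    refine hxy (he.separates x y fun p => ?_)
    by_contra hp
    exact hcon ⟨_, ⟨he.toC p, Algebra.subset_adjoin ⟨p, rfl⟩, rfl⟩, hp⟩
  rw [← subalgebra_coe]
  exact congr_arg (Subalgebra.toSubmodule <| StarSubalgebra.toSubalgebra ·)
    (ContinuousMap.starSubalgebra_topologicalClosure_eq_top_of_separatesPoints _ hsep)

variable [BorelSpace X] [SecondCountableTopologyEither X ℂ]
  [IsFiniteMeasure (volume : Measure X)]

/-- The members of a character family as elements of `L²`. -/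
def lp (he : IsCharacterFamily e) (p : κ) : Lp ℂ 2 (volume : Measure X) :=
  ContinuousMap.toLp (E := ℂ) 2 volume ℂ (he.toC p)

lemma coeFn_lp (he : IsCharacterFamily e) (p : κ) : he.lp p =ᵐ[volume] e p :=
  ContinuousMap.coeFn_toLp volume (he.toC p)

lemma inner_lp (he : IsCharacterFamily e) (p : κ) (f : Lp ℂ 2 (volume : Measure X)) :
    inner ℂ (he.lp p) f = ∫ x, f x * e (-p) x := by
  rw [L2.inner_def]
  refine integral_congr_ae ?_
  filter_upwards [he.coeFn_lp p] with x hx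
  simp [hx, he.map_neg, RCLike.inner_apply]

lemma inner_lp_lp [DecidableEq κ] (he : IsCharacterFamily e) (p q : κ) :
    inner ℂ (he.lp p) (he.lp q) =
      if p = q then ((volume : Measure X).real Set.univ : ℂ) else 0 := by
  have h : inner ℂ (he.lp p) (he.lp q) = ∫ x, e (q - p) x := by
    rw [inner_lp]
    refine integral_congr_ae ?_
    filter_upwards [he.coeFn_lp q] with x hx
    rw [hx, ← he.map_add, sub_eq_add_neg]
  rw [h]
  split_ifs with hpq
  · subst hpq
    simp [he.map_zero]
  · exact he.integral_eq_zero _ (sub_ne_zero.2 (Ne.symm hpq))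

variable [NormalSpace X] [(volume : Measure X).WeaklyRegular]

lemma span_lp_closure_eq_top (he : IsCharacterFamily e) :
    (Submodule.span ℂ (Set.range he.lp)).topologicalClosure = ⊤ := by
  convert!
    (ContinuousMap.toLp_denseRange ℂ (volume : Measure X) ℂ
        (p := 2) (by simp)).topologicalClosure_map_submodule
      he.span_closure_eq_top
  erw [Submodule.map_span]
  rw [← Set.range_comp]
  rfl

/-- Continuous linear maps that agree on a character family are equal. -/
lemma clm_ext (he : IsCharacterFamily e) {F : Type*} [NormedAddCommGroup F] [NormedSpace ℂ F]
    {S T : Lp ℂ 2 (volume : Measure X) →L[ℂ] F} (h : ∀ p, S (he.lp p) = T (he.lp p)) : S = T := by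
  refine ContinuousLinearMap.ext_on (s := Set.range he.lp) ?_ ?_
  · exact (Submodule.dense_iff_topologicalClosure_eq_top).2 he.span_lp_closure_eq_top
  · rintro _ ⟨p, rfl⟩
    exact h p

/-- The normalized Hilbert basis of `L²` given by a character family. -/
def basis (he : IsCharacterFamily e) (hX : 0 < (volume : Measure X).real Set.univ) :
    HilbertBasis κ ℂ (Lp ℂ 2 (volume : Measure X)) :=
  HilbertBasis.mk
    (v := fun p => (((Real.sqrt ((volume : Measure X).real Set.univ))⁻¹ : ℝ) : ℂ) • he.lp p)
    (by
      classical
      rw [orthonormal_iff_ite]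
      intro p q
      rw [inner_smul_left, inner_smul_right, he.inner_lp_lp]
      split_ifs
      · rw [Complex.conj_ofReal, ← Complex.ofReal_mul, ← Complex.ofReal_mul, ← mul_assoc,
          ← mul_inv, Real.mul_self_sqrt hX.le, inv_mul_cancel₀ hX.ne', Complex.ofReal_one]
      · simp)
    (by
      rw [← he.span_lp_closure_eq_top]
      refine Submodule.topologicalClosure_mono (Submodule.span_le.2 ?_)
      rintro _ ⟨p, rfl⟩
      have hc : (((Real.sqrt ((volume : Measure X).real Set.univ))⁻¹ : ℝ) : ℂ) ≠ 0 := by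
        simpa using (Real.sqrt_pos.2 hX).ne'
      exact (Submodule.smul_mem_iff _ hc).1 (Submodule.subset_span ⟨p, rfl⟩))

lemma basis_apply (he : IsCharacterFamily e) (hX : 0 < (volume : Measure X).real Set.univ) (p : κ) :
    he.basis hX p = (((Real.sqrt ((volume : Measure X).real Set.univ))⁻¹ : ℝ) : ℂ) • he.lp p := by
  rw [basis, HilbertBasis.coe_mk]

/-- The Fourier series of an `L²` function. -/
lemma hasSum_inner_smul (he : IsCharacterFamily e) (hX : 0 < (volume : Measure X).real Set.univ)
    (f : Lp ℂ 2 (volume : Measure X)) :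
    HasSum (fun p => inner ℂ (he.lp p) f • he.lp p)
      (((volume : Measure X).real Set.univ : ℂ) • f) := by
  have h := ((he.basis hX).hasSum_repr f).const_smul ((volume : Measure X).real Set.univ : ℂ)
  convert! h using 2 with p
  rw [HilbertBasis.repr_apply_apply, basis_apply, inner_smul_left, smul_smul, smul_smul,
    Complex.conj_ofReal]
  congr 1
  have h1 : (((volume : Measure X).real Set.univ : ℝ) : ℂ) =
      ((Real.sqrt ((volume : Measure X).real Set.univ) : ℝ) : ℂ) *
        ((Real.sqrt ((volume : Measure X).real Set.univ) : ℝ) : ℂ) := by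
    rw [← Complex.ofReal_mul, Real.mul_self_sqrt hX.le]
  have h2 : ((Real.sqrt ((volume : Measure X).real Set.univ) : ℝ) : ℂ) ≠ 0 := by
    simpa using (Real.sqrt_pos.2 hX).ne'
  rw [h1, Complex.ofReal_inv]
  field_simp

/-- Parseval's identity. -/
lemma hasSum_norm_inner_sq (he : IsCharacterFamily e)
    (hX : 0 < (volume : Measure X).real Set.univ) (f : Lp ℂ 2 (volume : Measure X)) :
    HasSum (fun p => ‖inner ℂ (he.lp p) f‖ ^ 2) ((volume : Measure X).real Set.univ * ‖f‖ ^ 2) := by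
  have h := (innerSL ℂ f).hasSum (he.hasSum_inner_smul hX f)
  rw [← Complex.hasSum_ofReal]
  convert! h using 1
  · funext p
    rw [innerSL_apply_apply, inner_smul_right, ← inner_conj_symm f,
      Complex.mul_conj, Complex.normSq_eq_norm_sq]
  · rw [innerSL_apply_apply, inner_smul_right, inner_self_eq_norm_sq_to_K]
    push_cast
    rfl

end General

/-- The product of character families. -/
lemma pi {ι κ X : Type*} [Fintype ι] [AddCommGroup κ] [TopologicalSpace X] [MeasureSpace X]
    [SigmaFinite (volume : Measure X)]
    {e : κ → X → ℂ} (he : IsCharacterFamily e) :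
    IsCharacterFamily fun (p : ι → κ) (x : ι → X) => ∏ i, e (p i) (x i) where
  continuous p := continuous_finsetProd _ fun i _ => (he.continuous (p i)).comp (continuous_apply i)
  map_zero x := by simp [he.map_zero]
  map_add p q x := by simp [he.map_add, Finset.prod_mul_distrib]
  map_neg p x := by simp [he.map_neg]
  integral_eq_zero p hp := by
    obtain ⟨i, hi⟩ := Function.ne_iff.1 hp
    rw [integral_fintype_prod_volume_eq_prod (fun i x => e (p i) x)]
    exact Finset.prod_eq_zero (Finset.mem_univ i) (he.integral_eq_zero _ hi)
  separates x y h := by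
    classical
    funext i
    refine he.separates _ _ fun k => ?_
    -- A character supported on the single factor i sees only the coordinate i, so the factors are
    -- separated one at a time.
    have key : ∀ z : ι → X, ∏ j, e ((Pi.single i k : ι → κ) j) (z j) = e k (z i) := by
      intro z
      rw [Finset.prod_eq_single i]
      · simp
      · intro j _ hj
        simp [Pi.single_eq_of_ne hj, he.map_zero]
      · simp
    rw [← key x, ← key y]
    exact h _

end IsCharacterFamily

/-! ### Plane waves on the torus and on configuration space -/

section Torus

variable {ℓ : ℝ} [hℓ : Fact (0 < ℓ)]

lemma isCharacterFamily_fourier :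
    IsCharacterFamily fun (n : ℤ) (x : AddCircle ℓ) => (fourier n x : ℂ) where
  continuous p := (fourier p).continuous
  map_zero x := fourier_zero
  map_add p q x := fourier_add
  map_neg p x := fourier_neg
  integral_eq_zero p hp := by
    have h := fourierCoeff_fourier (T := ℓ) p
    have h0 := congrFun h 0
    simp only [fourierCoeff, neg_zero, fourier_zero, one_smul, Pi.single_eq_of_ne hp.symm] at h0
    rw [AddCircle.volume_eq_smul_haarAddCircle, integral_smul_measure, h0, smul_zero]
  separates x y h := by
    have h1 := h 1
    rw [fourier_one, fourier_one] at h1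
    exact AddCircle.injective_toCircle hℓ.out.ne' (Circle.ext h1)

lemma isCharacterFamily_planeWave {d : ℕ} :
    IsCharacterFamily fun (n : Fin d → ℤ) (x : Torus d ℓ) => planeWave n x :=
  isCharacterFamily_fourier.pi

/-- The plane wave with momenta `p` on the configuration space `Λ^N`. -/
def configWave {d N : ℕ} (p : Fin N → Fin d → ℤ) (x : Fin N → Torus d ℓ) : ℂ :=
  ∏ j, planeWave (p j) (x j)

lemma isCharacterFamily_configWave {d N : ℕ} :
    IsCharacterFamily fun (p : Fin N → Fin d → ℤ) (x : Fin N → Torus d ℓ) => configWave p x :=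
  isCharacterFamily_planeWave.pi

lemma volume_real_torus {d : ℕ} : (volume : Measure (Torus d ℓ)).real Set.univ = ℓ ^ d := by
  rw [measureReal_def, volume_pi, Measure.pi_univ]
  simp [AddCircle.measure_univ, hℓ.out.le]

lemma volume_real_config {d N : ℕ} :
    (volume : Measure (Fin N → Torus d ℓ)).real Set.univ = (ℓ ^ d) ^ N := by
  rw [measureReal_def, volume_pi, Measure.pi_univ]
  rw [Finset.prod_const, ENNReal.toReal_pow, ← measureReal_def, volume_real_torus]
  simp

/-- `L²(Λ)`. -/
abbrev OneL2 (d : ℕ) (ℓ : ℝ) [Fact (0 < ℓ)] : Type := Lp ℂ 2 (volume : Measure (Torus d ℓ))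

/-- `L²(Λ^N)`. -/
abbrev ConfigL2 (d : ℕ) (ℓ : ℝ) [Fact (0 < ℓ)] (N : ℕ) : Type :=
  Lp ℂ 2 (volume : Measure (Fin N → Torus d ℓ))

/-- The plane wave as an element of `L²(Λ)`. -/
def oneE {d : ℕ} (n : Fin d → ℤ) : OneL2 d ℓ := isCharacterFamily_planeWave.lp n

/-- The plane wave as an element of `L²(Λ^N)`. -/
def configE {d N : ℕ} (p : Fin N → Fin d → ℤ) : ConfigL2 d ℓ N :=
  isCharacterFamily_configWave.lp p

lemma config_clm_ext {d N : ℕ} {F : Type*} [NormedAddCommGroup F] [NormedSpace ℂ F]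
    {S T : ConfigL2 d ℓ N →L[ℂ] F} (h : ∀ p, S (configE p) = T (configE p)) : S = T :=
  isCharacterFamily_configWave.clm_ext h

end Torus

/-! ### Averaging over one coordinate -/

section Update

variable {ι X : Type*} [Fintype ι] [DecidableEq ι] [MeasureSpace X]
  [IsFiniteMeasure (volume : Measure X)] [NeZero (volume : Measure X)]

omit [Fintype ι] [IsFiniteMeasure (volume : Measure X)] [NeZero (volume : Measure X)] in
lemma measurable_update_prod (i : ι) :
    Measurable fun z : (ι → X) × X => Function.update z.1 i z.2 := by
  refine measurable_pi_lambda _ fun j => ?_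
  by_cases h : j = i
  · subst h
    simpa using measurable_snd
  · simp only [Function.update_of_ne h]
    exact (measurable_pi_apply j).comp measurable_fst

/-- Overwriting coordinate i by an independent point forgets the old value, whose total mass is the
factor on the right. This is Fubini for one coordinate without splitting the product space. -/
lemma map_update_prod (i : ι) :
    Measure.map (fun z : (ι → X) × X => Function.update z.1 i z.2) (volume.prod volume) =
      (volume : Measure X) Set.univ • (volume : Measure (ι → X)) := by
  set c := (volume : Measure X) Set.univ with hc
  have hc0 : c ≠ 0 := by simpa [hc] using NeZero.ne (volume : Measure X)
  have hct : c ≠ ∞ := measure_ne_top _ _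
  -- Solved for the product measure, the claim can be checked on boxes: the old coordinate i is
  -- unconstrained and the new one must lie in the i-th side.
  have key : (volume : Measure (ι → X)) = c⁻¹ •
      Measure.map (fun z : (ι → X) × X => Function.update z.1 i z.2) (volume.prod volume) := by
    rw [volume_pi]
    refine Measure.pi_eq fun s hs => ?_
    rw [Measure.smul_apply, Measure.map_apply (measurable_update_prod i)
      (MeasurableSet.univ_pi hs)]
    have : (fun z : (ι → X) × X => Function.update z.1 i z.2) ⁻¹' Set.univ.pi s =
        (Set.univ.pi (Function.update s i Set.univ)) ×ˢ s i := by
      ext ⟨x, y⟩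
      simp only [Set.mem_preimage, Set.mem_pi, Set.mem_univ, true_imp_iff, Set.mem_prod]
      constructor
      · intro h
        refine ⟨fun j => ?_, by simpa using h i⟩
        by_cases hj : j = i
        · subst hj; simp
        · simpa [hj] using h j
      · rintro ⟨h1, h2⟩ j
        by_cases hj : j = i
        · subst hj; simpa using h2
        · simpa [hj] using h1 j
    rw [this, Measure.prod_prod, Measure.pi_pi, ← Finset.mul_prod_erase _ _
      (Finset.mem_univ i), ← Finset.mul_prod_erase _ (fun j => volume (s j)) (Finset.mem_univ i),
      Function.update_self, ← hc]
    have : ∏ x ∈ Finset.univ.erase i, volume (Function.update s i Set.univ x) =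
        ∏ x ∈ Finset.univ.erase i, volume (s x) :=
      Finset.prod_congr rfl fun j hj => by rw [Function.update_of_ne (Finset.ne_of_mem_erase hj)]
    rw [this, smul_eq_mul, mul_assoc, ← mul_assoc, ENNReal.inv_mul_cancel hc0 hct, one_mul,
      mul_comm]
  nth_rewrite 2 [key]
  rw [smul_smul, ENNReal.mul_inv_cancel hc0 hct, one_smul]

lemma quasiMeasurePreserving_update (i : ι) :
    Measure.QuasiMeasurePreserving (fun z : (ι → X) × X => Function.update z.1 i z.2)
      (volume.prod volume) volume :=
  ⟨measurable_update_prod i, by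
    rw [map_update_prod]
    exact Measure.smul_absolutelyContinuous⟩

lemma ae_ae_update {p : (ι → X) → Prop} (h : ∀ᵐ x, p x) (i : ι) :
    ∀ᵐ x : ι → X, ∀ᵐ y : X, p (Function.update x i y) :=
  Measure.ae_ae_of_ae_prod ((quasiMeasurePreserving_update i).ae h)

lemma lintegral_lintegral_update {F : (ι → X) → ℝ≥0∞} (hF : AEMeasurable F volume) (i : ι) :
    ∫⁻ x, ∫⁻ y, F (Function.update x i y) = volume (Set.univ : Set X) * ∫⁻ x, F x := by
  have h1 := lintegral_prod (μ := (volume : Measure (ι → X))) (ν := (volume : Measure X))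
    (fun z => F (Function.update z.1 i z.2))
    (hF.comp_quasiMeasurePreserving (quasiMeasurePreserving_update i))
  rw [← h1, ← smul_eq_mul, ← lintegral_smul_measure, ← map_update_prod i,
    lintegral_map' _ (measurable_update_prod i).aemeasurable]
  rw [map_update_prod]
  exact hF.smul_measure _

lemma integrable_update_prod {F : (ι → X) → ℂ} (hF : Integrable F) (i : ι) :
    Integrable (fun z : (ι → X) × X => F (Function.update z.1 i z.2)) (volume.prod volume) := by
  refine Integrable.comp_measurable ?_ (measurable_update_prod i)
  rw [map_update_prod]
  exact hF.smul_measure (measure_ne_top _ _)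

lemma ae_integrable_update {F : (ι → X) → ℂ} (hF : Integrable F) (i : ι) :
    ∀ᵐ x : ι → X, Integrable fun y => F (Function.update x i y) :=
  (integrable_update_prod hF i).prod_right_ae

/-- The average over the coordinate `i`. -/
def coordAvg (i : ι) (F : (ι → X) → ℂ) (x : ι → X) : ℂ :=
  ((volume : Measure X).real Set.univ : ℂ)⁻¹ * ∫ y : X, F (Function.update x i y)

omit [Fintype ι] [IsFiniteMeasure (volume : Measure X)] [NeZero (volume : Measure X)] in
lemma coordAvg_update (i : ι) (F : (ι → X) → ℂ) (x : ι → X) (y : X) :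
    coordAvg i F (Function.update x i y) = coordAvg i F x := by
  simp [coordAvg]

lemma coordAvg_congr (i : ι) {F G : (ι → X) → ℂ} (h : F =ᵐ[volume] G) :
    coordAvg i F =ᵐ[volume] coordAvg i G := by
  filter_upwards [ae_ae_update h i] with x hx
  simp only [coordAvg]
  rw [integral_congr_ae hx]

lemma coordAvg_add (i : ι) {F G : (ι → X) → ℂ} (hF : Integrable F) (hG : Integrable G) :
    coordAvg i (F + G) =ᵐ[volume] coordAvg i F + coordAvg i G := by
  filter_upwards [ae_integrable_update hF i, ae_integrable_update hG i] with x h1 h2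
  simp only [coordAvg, Pi.add_apply]
  rw [integral_add h1 h2, mul_add]

omit [Fintype ι] [IsFiniteMeasure (volume : Measure X)] [NeZero (volume : Measure X)] in
lemma coordAvg_smul (i : ι) (c : ℂ) (F : (ι → X) → ℂ) :
    coordAvg i (c • F) = c • coordAvg i F := by
  funext x
  simp only [coordAvg, Pi.smul_apply, smul_eq_mul, integral_const_mul]
  ring

lemma aestronglyMeasurable_coordAvg (i : ι) {F : (ι → X) → ℂ}
    (hF : AEStronglyMeasurable F volume) : AEStronglyMeasurable (coordAvg i F) volume :=
  ((hF.comp_quasiMeasurePreserving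
    (quasiMeasurePreserving_update i)).integral_prod_right').const_mul _

omit [IsFiniteMeasure (volume : Measure X)] [NeZero (volume : Measure X)] in
lemma sq_lintegral_le {f : X → ℝ≥0∞} (hf : AEMeasurable f volume) :
    (∫⁻ y, f y) ^ 2 ≤ volume (Set.univ : Set X) * ∫⁻ y, f y ^ 2 := by
  have h := ENNReal.lintegral_mul_le_Lp_mul_Lq volume Real.HolderConjugate.two_two hf
    (g := fun _ => 1) aemeasurable_const
  simp only [Pi.mul_apply, mul_one, ENNReal.one_rpow, lintegral_one] at h
  calc (∫⁻ y, f y) ^ 2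
      ≤ ((∫⁻ y, f y ^ (2 : ℝ)) ^ (1 / 2 : ℝ) * volume Set.univ ^ (1 / 2 : ℝ)) ^ 2 := by gcongr
    _ = volume (Set.univ : Set X) * ∫⁻ y, f y ^ 2 := by
      rw [mul_pow, ← ENNReal.rpow_natCast, ← ENNReal.rpow_natCast, ← ENNReal.rpow_mul,
        ← ENNReal.rpow_mul]
      norm_num
      rw [mul_comm]

/-- Cauchy–Schwarz in the averaged coordinate, followed by `lintegral_lintegral_update`; this makes
P_i a contraction of L². -/
lemma lintegral_coordAvg_sq_le (i : ι) {F : (ι → X) → ℂ} (hF : AEStronglyMeasurable F volume) :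
    ∫⁻ x, ‖coordAvg i F x‖ₑ ^ 2 ≤ ∫⁻ x, ‖F x‖ₑ ^ 2 := by
  set c := (volume : Measure X) Set.univ with hc
  have hc0 : c ≠ 0 := by simpa [hc] using NeZero.ne (volume : Measure X)
  have hct : c ≠ ∞ := measure_ne_top _ _
  have hc1 : ‖((volume : Measure X).real Set.univ : ℂ)⁻¹‖ₑ = c⁻¹ := by
    rw [enorm_inv, ← ofReal_norm, Complex.norm_real, Real.norm_of_nonneg measureReal_nonneg,
      measureReal_def, ENNReal.ofReal_toReal hct]
    have : (volume : Measure X).real Set.univ ≠ 0 := by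
      rw [measureReal_def]; exact (ENNReal.toReal_pos hc0 hct).ne'
    exact_mod_cast this
  have hmeas : ∀ᵐ x : ι → X, AEStronglyMeasurable (fun y => F (Function.update x i y)) volume :=
    (hF.comp_quasiMeasurePreserving (quasiMeasurePreserving_update i)).prodMk_left
  calc ∫⁻ x, ‖coordAvg i F x‖ₑ ^ 2
      ≤ ∫⁻ x, c⁻¹ * ∫⁻ y, ‖F (Function.update x i y)‖ₑ ^ 2 := by
        refine lintegral_mono_ae ?_
        filter_upwards [hmeas] with x hx
        rw [coordAvg, enorm_mul, hc1, mul_pow]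
        calc c⁻¹ ^ 2 * ‖∫ y, F (Function.update x i y)‖ₑ ^ 2
            ≤ c⁻¹ ^ 2 * (c * ∫⁻ y, ‖F (Function.update x i y)‖ₑ ^ 2) := by
              gcongr
              exact (pow_le_pow_left' (enorm_integral_le_lintegral_enorm _) 2).trans
                (sq_lintegral_le hx.enorm)
          _ = c⁻¹ * ∫⁻ y, ‖F (Function.update x i y)‖ₑ ^ 2 := by
              rw [← mul_assoc, sq, mul_assoc c⁻¹, ENNReal.inv_mul_cancel hc0 hct, mul_one]
    _ = ∫⁻ x, ‖F x‖ₑ ^ 2 := by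
        rw [lintegral_const_mul' _ _ (ENNReal.inv_ne_top.2 hc0),
          lintegral_lintegral_update (F := fun x => ‖F x‖ₑ ^ 2) (hF.enorm.pow_const 2),
          ← mul_assoc, ENNReal.inv_mul_cancel hc0 hct, one_mul]

end Update

/-! ### Square-integrability criteria and multiplication by continuous functions -/

section Lp2

variable {α : Type*} [MeasureSpace α]

lemma eLpNorm_two_eq (F : α → ℂ) :
    eLpNorm F 2 volume = (∫⁻ x, ‖F x‖ₑ ^ 2) ^ (1 / 2 : ℝ) := by
  rw [eLpNorm_eq_lintegral_rpow_enorm_toReal (by norm_num) (by norm_num)]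
  norm_num

lemma memLp_two_of_lintegral_le {F G : α → ℂ} {C : ℝ≥0∞} (hC : C ≠ ∞)
    (hF : AEStronglyMeasurable F volume) (hG : MemLp G 2 volume)
    (h : ∫⁻ x, ‖F x‖ₑ ^ 2 ≤ C * ∫⁻ x, ‖G x‖ₑ ^ 2) : MemLp F 2 volume := by
  refine ⟨hF, ?_⟩
  rw [eLpNorm_two_eq]
  have hG2 := hG.2
  rw [eLpNorm_two_eq, ENNReal.rpow_lt_top_iff_of_pos (by norm_num)] at hG2
  rw [ENNReal.rpow_lt_top_iff_of_pos (by norm_num)]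
  exact h.trans_lt (ENNReal.mul_lt_top hC.lt_top hG2)

lemma norm_le_of_lintegral_le {F G : Lp ℂ 2 (volume : Measure α)} {C : ℝ} (hC : 0 ≤ C)
    (h : ∫⁻ x, ‖F x‖ₑ ^ 2 ≤ ENNReal.ofReal C ^ 2 * ∫⁻ x, ‖G x‖ₑ ^ 2) : ‖F‖ ≤ C * ‖G‖ := by
  rw [Lp.norm_def, Lp.norm_def, ← ENNReal.toReal_ofReal hC, ← ENNReal.toReal_mul]
  refine ENNReal.toReal_mono (ENNReal.mul_ne_top ENNReal.ofReal_ne_top (Lp.eLpNorm_ne_top G)) ?_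
  rw [eLpNorm_two_eq, eLpNorm_two_eq]
  calc (∫⁻ x, ‖F x‖ₑ ^ 2) ^ (1 / 2 : ℝ)
      ≤ (ENNReal.ofReal C ^ 2 * ∫⁻ x, ‖G x‖ₑ ^ 2) ^ (1 / 2 : ℝ) := by gcongr
    _ = _ := by
      rw [ENNReal.mul_rpow_of_nonneg _ _ (by norm_num), ← ENNReal.rpow_natCast,
        ← ENNReal.rpow_mul]
      norm_num

variable [TopologicalSpace α] [CompactSpace α] [BorelSpace α] [SecondCountableTopologyEither α ℂ]

omit [SecondCountableTopologyEither α ℂ] [BorelSpace α] in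
lemma lintegral_mul_sq_le (u : C(α, ℂ)) (F : α → ℂ) :
    ∫⁻ x, ‖u x * F x‖ₑ ^ 2 ≤ ENNReal.ofReal ‖u‖ ^ 2 * ∫⁻ x, ‖F x‖ₑ ^ 2 := by
  rw [← lintegral_const_mul' _ _ (by simp)]
  refine lintegral_mono fun x => ?_
  rw [enorm_mul, mul_pow]
  gcongr
  rw [← ofReal_norm]
  exact ENNReal.ofReal_le_ofReal (u.norm_coe_le_norm x)

lemma memLp_continuous_mul (u : C(α, ℂ)) {F : α → ℂ} (hF : MemLp F 2 volume) :
    MemLp (fun x => u x * F x) 2 volume :=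
  memLp_two_of_lintegral_le (C := ENNReal.ofReal ‖u‖ ^ 2) (by simp)
    (u.continuous.aestronglyMeasurable.mul hF.1) hF (lintegral_mul_sq_le u F)

/-- Multiplication by a continuous function as an operator on `L²`. -/
def mulC (u : C(α, ℂ)) : Lp ℂ 2 (volume : Measure α) →L[ℂ] Lp ℂ 2 (volume : Measure α) :=
  LinearMap.mkContinuous
    { toFun := fun F => (memLp_continuous_mul u (Lp.memLp F)).toLp
      map_add' := fun F G => by
        ext1
        filter_upwards [MemLp.coeFn_toLp (memLp_continuous_mul u (Lp.memLp (F + G))),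
          MemLp.coeFn_toLp (memLp_continuous_mul u (Lp.memLp F)),
          MemLp.coeFn_toLp (memLp_continuous_mul u (Lp.memLp G)), Lp.coeFn_add F G,
          Lp.coeFn_add (memLp_continuous_mul u (Lp.memLp F)).toLp
            (memLp_continuous_mul u (Lp.memLp G)).toLp] with x h1 h2 h3 h4 h5
        rw [h1, h5, Pi.add_apply, h2, h3, h4, Pi.add_apply, mul_add]
      map_smul' := fun c F => by
        ext1
        filter_upwards [MemLp.coeFn_toLp (memLp_continuous_mul u (Lp.memLp (c • F))),
          MemLp.coeFn_toLp (memLp_continuous_mul u (Lp.memLp F)), Lp.coeFn_smul c F,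
          Lp.coeFn_smul c (memLp_continuous_mul u (Lp.memLp F)).toLp] with x h1 h2 h3 h4
        simp only [RingHom.id_apply]
        rw [h1, h4, Pi.smul_apply, h2, h3, Pi.smul_apply, smul_eq_mul, smul_eq_mul]
        ring }
    ‖u‖ (fun F => by
      refine norm_le_of_lintegral_le (norm_nonneg _) ?_
      refine le_trans (le_of_eq ?_) (lintegral_mul_sq_le u F)
      refine lintegral_congr_ae ?_
      filter_upwards [MemLp.coeFn_toLp (memLp_continuous_mul u (Lp.memLp F))] with x hx
      simp only [LinearMap.coe_mk, AddHom.coe_mk, hx])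

lemma coeFn_mulC (u : C(α, ℂ)) (F : Lp ℂ 2 (volume : Measure α)) :
    mulC u F =ᵐ[volume] fun x => u x * F x :=
  MemLp.coeFn_toLp (memLp_continuous_mul u (Lp.memLp F))

end Lp2

/-! ### Operators on `L²(Λ^N)` -/

section Operators

variable {d : ℕ} {ℓ : ℝ} [hℓ : Fact (0 < ℓ)] {N : ℕ}

instance : NeZero (volume : Measure (Torus d ℓ)) := ⟨by
  intro h
  have h1 := volume_real_torus (d := d) (ℓ := ℓ)
  rw [h] at h1
  rw [measureReal_zero_apply] at h1
  exact (pow_pos hℓ.out d).ne h1⟩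

lemma projP_eq_coordAvg (j : Fin N) (Ψ : WaveFn d ℓ N) : projP j Ψ = coordAvg j Ψ := by
  funext x
  simp only [projP, coordAvg, volume_real_torus]

lemma memLp_projP (i : Fin N) {Ψ : WaveFn d ℓ N} (hΨ : MemLp Ψ 2 volume) :
    MemLp (projP i Ψ) 2 volume := by
  rw [projP_eq_coordAvg]
  refine memLp_two_of_lintegral_le (C := 1) (by simp) (aestronglyMeasurable_coordAvg i hΨ.1) hΨ ?_
  rw [one_mul]
  exact lintegral_coordAvg_sq_le i hΨ.1

lemma projP_congr (i : Fin N) {Ψ Φ : WaveFn d ℓ N} (h : Ψ =ᵐ[volume] Φ) :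
    projP i Ψ =ᵐ[volume] projP i Φ := by
  rw [projP_eq_coordAvg, projP_eq_coordAvg]
  exact coordAvg_congr i h

lemma projP_add (i : Fin N) {Ψ Φ : WaveFn d ℓ N} (hΨ : MemLp Ψ 2 volume)
    (hΦ : MemLp Φ 2 volume) : projP i (Ψ + Φ) =ᵐ[volume] projP i Ψ + projP i Φ := by
  simp only [projP_eq_coordAvg]
  exact coordAvg_add i (hΨ.integrable (by norm_num)) (hΦ.integrable (by norm_num))

lemma projP_smul (i : Fin N) (c : ℂ) (Ψ : WaveFn d ℓ N) : projP i (c • Ψ) = c • projP i Ψ := by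
  simp only [projP_eq_coordAvg]
  exact coordAvg_smul i c Ψ

/-- The projection `P_i` on `L²(Λ^N)`. -/
def opP (i : Fin N) : ConfigL2 d ℓ N →L[ℂ] ConfigL2 d ℓ N :=
  LinearMap.mkContinuous
    { toFun := fun F => (memLp_projP i (Lp.memLp F)).toLp
      map_add' := fun F G => by
        ext1
        filter_upwards [MemLp.coeFn_toLp (memLp_projP i (Lp.memLp (F + G))),
          MemLp.coeFn_toLp (memLp_projP i (Lp.memLp F)),
          MemLp.coeFn_toLp (memLp_projP i (Lp.memLp G)), projP_congr i (Lp.coeFn_add F G),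
          projP_add i (Lp.memLp F) (Lp.memLp G),
          Lp.coeFn_add (memLp_projP i (Lp.memLp F)).toLp
            (memLp_projP i (Lp.memLp G)).toLp] with x h1 h2 h3 h4 h5 h6
        rw [h1, h6, Pi.add_apply, h2, h3, h4, h5, Pi.add_apply]
      map_smul' := fun c F => by
        ext1
        filter_upwards [MemLp.coeFn_toLp (memLp_projP i (Lp.memLp (c • F))),
          MemLp.coeFn_toLp (memLp_projP i (Lp.memLp F)), projP_congr i (Lp.coeFn_smul c F),
          Lp.coeFn_smul c (memLp_projP i (Lp.memLp F)).toLp] with x h1 h2 h3 h4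
        simp only [RingHom.id_apply]
        rw [h1, h4, Pi.smul_apply, h2, h3, projP_smul, Pi.smul_apply] }
    1 (fun F => by
      refine norm_le_of_lintegral_le zero_le_one ?_
      rw [ENNReal.ofReal_one, one_pow, one_mul]
      have h := lintegral_coordAvg_sq_le i (Lp.aestronglyMeasurable F)
      rw [← projP_eq_coordAvg] at h
      refine le_trans (le_of_eq ?_) h
      refine lintegral_congr_ae ?_
      filter_upwards [MemLp.coeFn_toLp (memLp_projP i (Lp.memLp F))] with x hx
      simp only [LinearMap.coe_mk, AddHom.coe_mk, hx])

/-- The projection `Q_i = 1 - P_i` on `L²(Λ^N)`. -/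
def opQ (i : Fin N) : ConfigL2 d ℓ N →L[ℂ] ConfigL2 d ℓ N := 1 - opP i

lemma coeFn_opP (i : Fin N) (F : ConfigL2 d ℓ N) : opP i F =ᵐ[volume] projP i F :=
  MemLp.coeFn_toLp (memLp_projP i (Lp.memLp F))

lemma opQ_apply (i : Fin N) (F : ConfigL2 d ℓ N) : opQ i F = F - opP i F := rfl

/-! Functions representing elements of `L²`. -/

/-- `Ψ` represents the element `ψ` of `L²(Λ^N)`. -/
def Represents (Ψ : WaveFn d ℓ N) (ψ : ConfigL2 d ℓ N) : Prop := Ψ =ᵐ[volume] ψ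

namespace Represents

variable {Ψ Φ : WaveFn d ℓ N} {ψ φ : ConfigL2 d ℓ N}

lemma memLp (h : Represents Ψ ψ) : MemLp Ψ 2 volume := (memLp_congr_ae h).2 (Lp.memLp ψ)

lemma of_memLp (h : MemLp Ψ 2 volume) : Represents Ψ h.toLp := (MemLp.coeFn_toLp h).symm

lemma congr (h : Represents Φ ψ) (h' : Ψ =ᵐ[volume] Φ) : Represents Ψ ψ := h'.trans h

lemma add (h : Represents Ψ ψ) (h' : Represents Φ φ) : Represents (Ψ + Φ) (ψ + φ) :=
  (EventuallyEq.add h h').trans (Lp.coeFn_add ψ φ).symm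

lemma sub (h : Represents Ψ ψ) (h' : Represents Φ φ) : Represents (Ψ - Φ) (ψ - φ) :=
  (EventuallyEq.sub h h').trans (Lp.coeFn_sub ψ φ).symm

lemma smul (h : Represents Ψ ψ) (c : ℂ) : Represents (c • Ψ) (c • ψ) :=
  (EventuallyEq.const_smul h c).trans (Lp.coeFn_smul c ψ).symm

lemma zero : Represents (0 : WaveFn d ℓ N) 0 := (Lp.coeFn_zero ℂ 2 volume).symm

lemma sum {ι : Type*} (s : Finset ι) {Ψ : ι → WaveFn d ℓ N} {ψ : ι → ConfigL2 d ℓ N}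
    (h : ∀ i ∈ s, Represents (Ψ i) (ψ i)) : Represents (∑ i ∈ s, Ψ i) (∑ i ∈ s, ψ i) := by
  classical
  induction s using Finset.induction_on with
  | empty => simpa using zero
  | insert a s ha ih =>
    rw [Finset.sum_insert ha, Finset.sum_insert ha]
    exact (h a (Finset.mem_insert_self a s)).add
      (ih fun i hi => h i (Finset.mem_insert_of_mem hi))

lemma projP (h : Represents Ψ ψ) (i : Fin N) : Represents (projP i Ψ) (opP i ψ) :=
  (projP_congr i h).trans (coeFn_opP i ψ).symm

lemma projQ (h : Represents Ψ ψ) (i : Fin N) : Represents (projQ i Ψ) (opQ i ψ) :=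
  h.sub (h.projP i)

lemma mulC (h : Represents Ψ ψ) (u : C(Fin N → Torus d ℓ, ℂ)) :
    Represents (fun x => u x * Ψ x) (mulC u ψ) := by
  refine EventuallyEq.trans ?_ (coeFn_mulC u ψ).symm
  filter_upwards [h] with x hx
  rw [hx]

lemma eq_of_ae (h : Represents Ψ ψ) (h' : Represents Φ φ) (e : Ψ =ᵐ[volume] Φ) : ψ = φ :=
  Lp.ext (h.symm.trans (e.trans h'))

lemma ae_eq (h : Represents Ψ ψ) (h' : Represents Φ φ) (e : ψ = φ) : Ψ =ᵐ[volume] Φ := by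
  subst e
  exact h.trans h'.symm

end Represents

lemma represents_coe (ψ : ConfigL2 d ℓ N) : Represents (ψ : WaveFn d ℓ N) ψ :=
  EventuallyEq.rfl

/-- The bridge from pointwise-defined wave functions to the normed space L², where all convergence
arguments take place. -/
lemma hasSumL2_of_hasSum {ι : Type} {f : ι → WaveFn d ℓ N} {S : WaveFn d ℓ N}
    {f' : ι → ConfigL2 d ℓ N} {S' : ConfigL2 d ℓ N} (hf : ∀ k, Represents (f k) (f' k))
    (hS : Represents S S') (h : HasSum f' S') : HasSumL2 f S := by
  refine ⟨fun k => (hf k).memLp, hS.memLp, ?_⟩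
  have h2 := (Lp.tendsto_Lp_iff_tendsto_eLpNorm' _ _).1 h
  refine h2.congr fun s => ?_
  refine eLpNorm_congr_ae ?_
  exact (((Represents.sum s fun k _ => hf k).sub hS).trans (Lp.coeFn_sub _ _)).symm

/-! ### Characters under the operators -/

/-- The plane wave `e^{ikx_i}` as a continuous function on `Λ^N`. -/
def waveAt (i : Fin N) (k : Fin d → ℤ) : C(Fin N → Torus d ℓ, ℂ) :=
  ⟨fun x => planeWave k (x i),
    (isCharacterFamily_planeWave.continuous k).comp (continuous_apply i)⟩

lemma represents_configE (p : Fin N → Fin d → ℤ) :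
    Represents (fun x : Fin N → Torus d ℓ => configWave p x) (configE p) :=
  (isCharacterFamily_configWave.coeFn_lp p).symm

omit hℓ in
lemma configWave_update (p : Fin N → Fin d → ℤ) (x : Fin N → Torus d ℓ) (i : Fin N)
    (y : Torus d ℓ) :
    configWave p (Function.update x i y) =
      planeWave (p i) y * ∏ j ∈ Finset.univ.erase i, planeWave (p j) (x j) := by
  rw [configWave, ← Finset.mul_prod_erase _ _ (Finset.mem_univ i), Function.update_self]
  congr 1
  exact Finset.prod_congr rfl fun j hj => by rw [Function.update_of_ne (Finset.ne_of_mem_erase hj)]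

lemma integral_planeWave (k : Fin d → ℤ) :
    ∫ y : Torus d ℓ, planeWave k y = if k = 0 then ((ℓ ^ d : ℝ) : ℂ) else 0 := by
  split_ifs with h
  · subst h
    simp_rw [isCharacterFamily_planeWave.map_zero]
    rw [integral_const, volume_real_torus]
    simp
  · exact isCharacterFamily_planeWave.integral_eq_zero k h

lemma volume_ne_zero : ((ℓ ^ d : ℝ) : ℂ) ≠ 0 := by
  exact_mod_cast (pow_pos hℓ.out d).ne'

lemma opP_configE (i : Fin N) (p : Fin N → Fin d → ℤ) :
    opP i (configE p : ConfigL2 d ℓ N) = if p i = 0 then configE p else 0 := by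
  have h1 := (represents_configE (ℓ := ℓ) p).projP i
  have h2 : ∀ x : Fin N → Torus d ℓ, projP i (fun x => configWave p x) x =
      if p i = 0 then configWave p x else 0 := by
    intro x
    simp only [projP, configWave_update, integral_mul_const, integral_planeWave]
    split_ifs with h
    · rw [← mul_assoc, inv_mul_cancel₀ volume_ne_zero, one_mul, configWave,
        ← Finset.mul_prod_erase _ _ (Finset.mem_univ i), h, isCharacterFamily_planeWave.map_zero,
        one_mul]
    · simp
  rw [funext h2] at h1
  split_ifs with h
  · simp only [h, if_true] at h1
    exact h1.eq_of_ae (represents_configE p) EventuallyEq.rfl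
  · simp only [h, if_false] at h1
    exact h1.eq_of_ae Represents.zero EventuallyEq.rfl

lemma mulC_configE (i : Fin N) (k : Fin d → ℤ) (p : Fin N → Fin d → ℤ) :
    mulC (waveAt i k) (configE p : ConfigL2 d ℓ N) = configE (p + Pi.single i k) := by
  refine ((represents_configE p).mulC (waveAt i k)).eq_of_ae (represents_configE _) ?_
  refine Eventually.of_forall fun x => ?_
  simp only
  rw [isCharacterFamily_configWave.map_add, mul_comm]
  congr 1
  rw [configWave, Finset.prod_eq_single i]
  · simp [waveAt]
  · intro j _ hj
    rw [Pi.single_eq_of_ne hj, isCharacterFamily_planeWave.map_zero]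
  · simp

lemma opP_comp_self (i : Fin N) : (opP i : ConfigL2 d ℓ N →L[ℂ] _) * opP i = opP i := by
  refine config_clm_ext fun p => ?_
  simp only [mul_apply_eq_comp, opP_configE]
  split_ifs with h <;> simp [opP_configE, h]

lemma opP_comm (i j : Fin N) :
    (opP i : ConfigL2 d ℓ N →L[ℂ] _) * opP j = opP j * opP i := by
  refine config_clm_ext fun p => ?_
  simp only [mul_apply_eq_comp, opP_configE]
  split_ifs with h h' h' <;> simp [opP_configE, *]

/-- The operator `|Λ|⁻¹ |e^{iax}⟩⟨e^{ibx}|` acting on the variable `x_i`. -/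
def opT (i : Fin N) (a b : Fin d → ℤ) : ConfigL2 d ℓ N →L[ℂ] ConfigL2 d ℓ N :=
  mulC (waveAt i a) * opP i * mulC (waveAt i (-b))

/-- On plane waves the rank-one operator replaces momentum b of particle i by a and kills every
other momentum. -/
lemma opT_configE (i : Fin N) (a b : Fin d → ℤ) (p : Fin N → Fin d → ℤ) :
    opT i a b (configE p : ConfigL2 d ℓ N) =
      if p i = b then configE (Function.update p i a) else 0 := by
  simp only [opT, mul_apply_eq_comp, mulC_configE, opP_configE, Pi.add_apply,
    Pi.single_eq_same, add_neg_eq_zero]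
  split_ifs with h
  · rw [mulC_configE]
    congr 1
    funext j
    by_cases hj : j = i
    · subst hj; simp [h]
    · simp [hj]
  · simp

lemma opT_zero_zero (i : Fin N) : (opT i 0 0 : ConfigL2 d ℓ N →L[ℂ] _) = opP i := by
  refine config_clm_ext fun p => ?_
  simp only [opT_configE, opP_configE]
  split_ifs with h
  · rw [← h, Function.update_eq_self]
  · rfl

end Operators

/-! ### Multiplication by a pair function after a projection -/

section PairOperators

variable {d : ℕ} {ℓ : ℝ} [hℓ : Fact (0 < ℓ)] {N : ℕ}

lemma inner_configE_configE (p q : Fin N → Fin d → ℤ) :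
    inner ℂ (configE p : ConfigL2 d ℓ N) (configE q) =
      if p = q then (((ℓ ^ d) ^ N : ℝ) : ℂ) else 0 := by
  classical
  have h := (isCharacterFamily_configWave (d := d) (ℓ := ℓ) (N := N)).inner_lp_lp p q
  rw [volume_real_config] at h
  exact h

/-- Matrix elements between plane waves determine a bounded operator, because plane waves span a
dense subspace. -/
lemma adjoint_eq_of_inner_configE {S T : ConfigL2 d ℓ N →L[ℂ] ConfigL2 d ℓ N}
    (h : ∀ p q, inner ℂ (S (configE p)) (configE q) = inner ℂ (configE p) (T (configE q))) :
    ContinuousLinearMap.adjoint T = S := by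
  refine config_clm_ext fun p => ext_inner_right ℂ fun F => ?_
  rw [ContinuousLinearMap.adjoint_inner_left]
  have key : (innerSL ℂ (configE p : ConfigL2 d ℓ N)).comp T = innerSL ℂ (S (configE p)) :=
    config_clm_ext fun q => (h p q).symm
  exact congrArg (fun L => L F) key

lemma adjoint_opP (i : Fin N) :
    ContinuousLinearMap.adjoint (opP i : ConfigL2 d ℓ N →L[ℂ] _) = opP i := by
  refine adjoint_eq_of_inner_configE fun p q => ?_
  simp only [opP_configE]
  split_ifs with h h' h'
  · rfl
  · rw [inner_configE_configE, inner_zero_right, if_neg]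
    rintro rfl
    exact h' h
  · rw [inner_configE_configE, inner_zero_left, if_neg]
    rintro rfl
    exact h h'
  · simp

lemma adjoint_mulC_waveAt (i : Fin N) (k : Fin d → ℤ) :
    ContinuousLinearMap.adjoint (mulC (waveAt i k) : ConfigL2 d ℓ N →L[ℂ] _) =
      mulC (waveAt i (-k)) := by
  refine adjoint_eq_of_inner_configE fun p q => ?_
  simp only [mulC_configE, inner_configE_configE, Pi.single_neg, ← sub_eq_add_neg, sub_eq_iff_eq_add]

/-- With the other coordinates fixed, x_i ↦ x_i - x_j is a translation, so null sets pull back to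
null sets. This makes f(x_i - x_j) well defined for a class f in L²(Λ). -/
lemma quasiMeasurePreserving_sub {i j : Fin N} (hij : i ≠ j) :
    Measure.QuasiMeasurePreserving (fun x : Fin N → Torus d ℓ => x i - x j) volume volume := by
  have hm : Measurable fun x : Fin N → Torus d ℓ => x i - x j :=
    (measurable_pi_apply i).sub (measurable_pi_apply j)
  refine ⟨hm, Measure.AbsolutelyContinuous.mk fun s hs h0 => ?_⟩
  rw [Measure.map_apply hm hs]
  have h1 := lintegral_lintegral_update (X := Torus d ℓ)
    (F := fun x => s.indicator (fun _ => 1) (x i - x j))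
    (((measurable_const.indicator hs).comp hm).aemeasurable) i
  have h2 : ∀ x : Fin N → Torus d ℓ, ∫⁻ y, s.indicator (fun _ => (1 : ℝ≥0∞))
      (Function.update x i y i - Function.update x i y j) = 0 := by
    intro x
    simp only [Function.update_self, Function.update_of_ne hij.symm]
    rw [lintegral_sub_right_eq_self (μ := (volume : Measure (Torus d ℓ)))
      (fun y => s.indicator (fun _ => (1 : ℝ≥0∞)) y) (x j), lintegral_indicator hs]
    simp [h0]
  simp only [h2, lintegral_zero] at h1
  have h3 := (mul_eq_zero.1 h1.symm).resolve_left (by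
    simpa using NeZero.ne (volume : Measure (Torus d ℓ)))
  have h4 : (fun x : Fin N → Torus d ℓ => s.indicator (fun _ => (1 : ℝ≥0∞)) (x i - x j)) =
      ((fun x : Fin N → Torus d ℓ => x i - x j) ⁻¹' s).indicator (fun _ => 1) := rfl
  rw [h4, lintegral_indicator (hm hs)] at h3
  simpa using h3

/-- P_iΨ does not depend on x_i, so the x_i-integral acts on f alone and, by translation invariance,
gives ‖f‖². This is why f ∈ L² suffices for boundedness of f(x_i - x_j)P_i. -/
lemma lintegral_pair_mul_sq {i j : Fin N} (hij : i ≠ j) {f : Torus d ℓ → ℂ}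
    (hf : AEStronglyMeasurable f volume) {Ψ : WaveFn d ℓ N}
    (hΨ : AEStronglyMeasurable (projP i Ψ) volume) :
    ENNReal.ofReal (ℓ ^ d) * ∫⁻ x, ‖f (x i - x j) * projP i Ψ x‖ₑ ^ 2 =
      (∫⁻ y, ‖f y‖ₑ ^ 2) * ∫⁻ x, ‖projP i Ψ x‖ₑ ^ 2 := by
  have hvol : volume (Set.univ : Set (Torus d ℓ)) = ENNReal.ofReal (ℓ ^ d) := by
    rw [← volume_real_torus, measureReal_def, ENNReal.ofReal_toReal (measure_ne_top _ _)]
  rw [← hvol, ← lintegral_lintegral_update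
    (F := fun x => ‖f (x i - x j) * projP i Ψ x‖ₑ ^ 2)
    (((hf.comp_quasiMeasurePreserving (quasiMeasurePreserving_sub hij)).mul hΨ).enorm.pow_const 2)
    i, ← lintegral_const_mul'' _ (hΨ.enorm.pow_const 2)]
  refine lintegral_congr fun x => ?_
  simp only [projP_eq_coordAvg, coordAvg_update, Function.update_self,
    Function.update_of_ne hij.symm, enorm_mul, mul_pow]
  rw [lintegral_mul_const' _ _ (by simp)]
  congr 1
  exact lintegral_sub_right_eq_self (μ := (volume : Measure (Torus d ℓ)))
    (fun y => ‖f y‖ₑ ^ 2) (x j)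

lemma memLp_pair_mul {i j : Fin N} (hij : i ≠ j) {f : Torus d ℓ → ℂ} (hf : MemLp f 2 volume)
    {Ψ : WaveFn d ℓ N} (hΨ : MemLp Ψ 2 volume) :
    MemLp (fun x => f (x i - x j) * projP i Ψ x) 2 volume := by
  have hP := memLp_projP i hΨ
  have hc0 : ENNReal.ofReal (ℓ ^ d) ≠ 0 := by simpa using pow_pos hℓ.out d
  have hfin : ∫⁻ y, ‖f y‖ₑ ^ 2 ≠ ∞ := by
    have h2 := hf.2
    rw [eLpNorm_two_eq, ENNReal.rpow_lt_top_iff_of_pos (by norm_num)] at h2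
    exact h2.ne
  refine memLp_two_of_lintegral_le (C := (ENNReal.ofReal (ℓ ^ d))⁻¹ * ∫⁻ y, ‖f y‖ₑ ^ 2)
    (ENNReal.mul_ne_top (ENNReal.inv_ne_top.2 hc0) hfin)
    ((hf.1.comp_quasiMeasurePreserving (quasiMeasurePreserving_sub hij)).mul hP.1) hP (le_of_eq ?_)
  rw [mul_assoc, ← lintegral_pair_mul_sq hij hf.1 hP.1, ← mul_assoc,
    ENNReal.inv_mul_cancel hc0 ENNReal.ofReal_ne_top, one_mul]

lemma lintegral_enorm_sq_eq {α : Type*} [MeasureSpace α] (f : Lp ℂ 2 (volume : Measure α)) :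
    ∫⁻ x, ‖f x‖ₑ ^ 2 = ENNReal.ofReal ‖f‖ ^ 2 := by
  rw [Lp.norm_def, ENNReal.ofReal_toReal (Lp.eLpNorm_ne_top f), eLpNorm_two_eq,
    ← ENNReal.rpow_natCast, ← ENNReal.rpow_mul]
  norm_num

/-- The bounded operator `f(x_i - x_j) P_i` on `L²(Λ^N)`, for `f ∈ L²(Λ)` and `i ≠ j`. -/
def pairOpAux {i j : Fin N} (hij : i ≠ j) :
    OneL2 d ℓ →L[ℂ] ConfigL2 d ℓ N →L[ℂ] ConfigL2 d ℓ N :=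
  LinearMap.mkContinuous₂
    (LinearMap.mk₂ ℂ (fun f F => (memLp_pair_mul hij (Lp.memLp f) (Lp.memLp F)).toLp)
      (fun f g F => by
        ext1
        filter_upwards [MemLp.coeFn_toLp (memLp_pair_mul hij (Lp.memLp (f + g)) (Lp.memLp F)),
          MemLp.coeFn_toLp (memLp_pair_mul hij (Lp.memLp f) (Lp.memLp F)),
          MemLp.coeFn_toLp (memLp_pair_mul hij (Lp.memLp g) (Lp.memLp F)),
          (quasiMeasurePreserving_sub hij).ae (Lp.coeFn_add f g),
          Lp.coeFn_add (memLp_pair_mul hij (Lp.memLp f) (Lp.memLp F)).toLp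
            (memLp_pair_mul hij (Lp.memLp g) (Lp.memLp F)).toLp] with x h1 h2 h3 h4 h5
        rw [h1, h5, Pi.add_apply, h2, h3, h4, Pi.add_apply, add_mul])
      (fun c f F => by
        ext1
        filter_upwards [MemLp.coeFn_toLp (memLp_pair_mul hij (Lp.memLp (c • f)) (Lp.memLp F)),
          MemLp.coeFn_toLp (memLp_pair_mul hij (Lp.memLp f) (Lp.memLp F)),
          (quasiMeasurePreserving_sub hij).ae (Lp.coeFn_smul c f),
          Lp.coeFn_smul c (memLp_pair_mul hij (Lp.memLp f) (Lp.memLp F)).toLp] with x h1 h2 h3 h4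
        rw [h1, h4, Pi.smul_apply, h2, h3, Pi.smul_apply, smul_eq_mul, smul_eq_mul, mul_assoc])
      (fun f F G => by
        ext1
        filter_upwards [MemLp.coeFn_toLp (memLp_pair_mul hij (Lp.memLp f) (Lp.memLp (F + G))),
          MemLp.coeFn_toLp (memLp_pair_mul hij (Lp.memLp f) (Lp.memLp F)),
          MemLp.coeFn_toLp (memLp_pair_mul hij (Lp.memLp f) (Lp.memLp G)),
          projP_congr i (Lp.coeFn_add F G), projP_add i (Lp.memLp F) (Lp.memLp G),
          Lp.coeFn_add (memLp_pair_mul hij (Lp.memLp f) (Lp.memLp F)).toLp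
            (memLp_pair_mul hij (Lp.memLp f) (Lp.memLp G)).toLp] with x h1 h2 h3 h4 h5 h6
        rw [h1, h6, Pi.add_apply, h2, h3, h4, h5, Pi.add_apply, mul_add])
      (fun c f F => by
        ext1
        filter_upwards [MemLp.coeFn_toLp (memLp_pair_mul hij (Lp.memLp f) (Lp.memLp (c • F))),
          MemLp.coeFn_toLp (memLp_pair_mul hij (Lp.memLp f) (Lp.memLp F)),
          projP_congr i (Lp.coeFn_smul c F),
          Lp.coeFn_smul c (memLp_pair_mul hij (Lp.memLp f) (Lp.memLp F)).toLp] with x h1 h2 h3 h4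
        rw [h1, h4, Pi.smul_apply, h2, h3, projP_smul, Pi.smul_apply, smul_eq_mul, smul_eq_mul,
          mul_left_comm]))
    (Real.sqrt (ℓ ^ d))⁻¹
    (fun f F => by
      have hpos := pow_pos hℓ.out d
      have hc0 : ENNReal.ofReal (ℓ ^ d) ≠ 0 := by simpa using hpos
      rw [LinearMap.mk₂_apply]
      refine norm_le_of_lintegral_le (by positivity) ?_
      have h1 : ∫⁻ x, ‖((memLp_pair_mul hij (Lp.memLp f) (Lp.memLp F)).toLp :
          ConfigL2 d ℓ N) x‖ₑ ^ 2 =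
          ∫⁻ x, ‖f (x i - x j) * projP i F x‖ₑ ^ 2 := by
        refine lintegral_congr_ae ?_
        filter_upwards [MemLp.coeFn_toLp (memLp_pair_mul hij (Lp.memLp f) (Lp.memLp F))] with x hx
        rw [hx]
      have h2 := lintegral_pair_mul_sq hij (Lp.aestronglyMeasurable f)
        (memLp_projP i (Lp.memLp F)).1
      have h3 := lintegral_coordAvg_sq_le i (Lp.aestronglyMeasurable F)
      rw [← projP_eq_coordAvg] at h3
      rw [h1, ENNReal.ofReal_mul (by positivity), mul_pow, ← ENNReal.ofReal_pow (by positivity),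
        inv_pow, Real.sq_sqrt hpos.le, ENNReal.ofReal_inv_of_pos hpos, ← lintegral_enorm_sq_eq f,
        mul_assoc]
      calc ∫⁻ x, ‖f (x i - x j) * projP i F x‖ₑ ^ 2
          = (ENNReal.ofReal (ℓ ^ d))⁻¹ *
              (ENNReal.ofReal (ℓ ^ d) * ∫⁻ x, ‖f (x i - x j) * projP i F x‖ₑ ^ 2) := by
            rw [← mul_assoc, ENNReal.inv_mul_cancel hc0 ENNReal.ofReal_ne_top, one_mul]
        _ ≤ _ := by
            rw [h2]
            gcongr)

/-- The bounded operator `f(x_i - x_j) P_i` on `L²(Λ^N)`, for `f ∈ L²(Λ)`; zero if `i = j`. -/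
def pairOp (i j : Fin N) : OneL2 d ℓ →L[ℂ] ConfigL2 d ℓ N →L[ℂ] ConfigL2 d ℓ N :=
  if hij : i ≠ j then pairOpAux hij else 0

lemma represents_pairOp {i j : Fin N} (hij : i ≠ j) {f : Torus d ℓ → ℂ} {fE : OneL2 d ℓ}
    (hf : f =ᵐ[volume] fE) {Ψ : WaveFn d ℓ N} {ψ : ConfigL2 d ℓ N}
    (hΨ : Represents Ψ (opP i ψ)) :
    Represents (fun x => f (x i - x j) * Ψ x) (pairOp i j fE ψ) := by
  rw [pairOp, dif_pos hij]
  filter_upwards [MemLp.coeFn_toLp (memLp_pair_mul hij (Lp.memLp fE) (Lp.memLp ψ)), hΨ,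
    coeFn_opP i ψ, (quasiMeasurePreserving_sub hij).ae hf] with x h1 h2 h3 h4
  refine Eq.trans ?_ h1.symm
  simp only [h2, h3, h4]

omit hℓ in
lemma planeWave_sub (k : Fin d → ℤ) (x y : Torus d ℓ) :
    planeWave k (x - y) = planeWave k x * planeWave (-k) y := by
  simp only [planeWave, ← Finset.prod_mul_distrib]
  refine Finset.prod_congr rfl fun α _ => ?_
  rw [Pi.sub_apply, Pi.neg_apply, fourier_neg, sub_eq_add_neg, fourier_apply, smul_add,
    AddCircle.toCircle_add, smul_neg, Circle.coe_mul, fourier_neg', ← fourier_apply]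

lemma pairOp_oneE {i j : Fin N} (hij : i ≠ j) (k : Fin d → ℤ) :
    pairOp i j (oneE k : OneL2 d ℓ) = mulC (waveAt i k) * mulC (waveAt j (-k)) * opP i := by
  refine ContinuousLinearMap.ext fun ψ => ?_
  have h1 := represents_pairOp hij (isCharacterFamily_planeWave.coeFn_lp k).symm
    ((represents_coe (opP i ψ)))
  have h2 := ((represents_coe (opP i ψ)).mulC (waveAt j (-k))).mulC (waveAt i k)
  refine h1.eq_of_ae h2 (Eventually.of_forall fun x => ?_)
  simp only [planeWave_sub, waveAt, ContinuousMap.coe_mk, mul_assoc]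

/-- The Fourier coefficient of an element of `L²(Λ)`. -/
def oneHat (f : OneL2 d ℓ) (k : Fin d → ℤ) : ℂ := inner ℂ (oneE k) f

lemma oneHat_eq_fourierHat {f : Torus d ℓ → ℝ} {fE : OneL2 d ℓ}
    (hf : (fun x => (f x : ℂ)) =ᵐ[volume] fE) (k : Fin d → ℤ) : oneHat fE k = fourierHat f k := by
  rw [oneHat, oneE, IsCharacterFamily.inner_lp, fourierHat]
  refine integral_congr_ae ?_
  filter_upwards [hf] with x hx
  rw [hx]

/-- Continuous linear functions of `f ∈ L²(Λ)` are expanded in the Fourier series of `f`. -/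
lemma hasSum_oneHat_smul {F : Type*} [NormedAddCommGroup F] [NormedSpace ℂ F]
    (L : OneL2 d ℓ →L[ℂ] F) (f : OneL2 d ℓ) :
    HasSum (fun k => oneHat f k • L (oneE k)) (((ℓ ^ d : ℝ) : ℂ) • L f) := by
  have h := L.hasSum (isCharacterFamily_planeWave.hasSum_inner_smul
    (by rw [volume_real_torus]; exact pow_pos hℓ.out d) f)
  simp only [map_smul, volume_real_torus] at h
  exact h

/-- Used when the projections around f(x_i - x_j) annihilate the zero mode, so that the series runs
over k ≠ 0 only. -/
lemma hasSum_ne_zero {F : Type*} [NormedAddCommGroup F] [NormedSpace ℂ F]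
    (L : OneL2 d ℓ →L[ℂ] F) (hL : L (oneE 0) = 0) (f : OneL2 d ℓ) :
    HasSum (fun k : {k : Fin d → ℤ // k ≠ 0} => oneHat f k • L (oneE k))
      (((ℓ ^ d : ℝ) : ℂ) • L f) := by
  refine (hasSum_subtype_iff_of_support_subset (s := {k | k ≠ 0}) ?_).2 (hasSum_oneHat_smul L f)
  intro k hk h0
  subst h0
  simp [hL] at hk

/-- Momentum conservation: the average of f(x_i - x_j) over x_i is a constant. In the Fourier series
of f, sandwiching by P_i removes every mode except k = 0. -/
lemma opP_mul_pairOp {i j : Fin N} (hij : i ≠ j) (f : OneL2 d ℓ) :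
    opP i * pairOp i j f = (oneHat f 0 / ((ℓ ^ d : ℝ) : ℂ)) • (opP i : ConfigL2 d ℓ N →L[ℂ] _) := by
  have h := hasSum_oneHat_smul ((ContinuousLinearMap.mul ℂ _ (opP i)).comp (pairOp i j)) f
  have h2 : ∀ k, (ContinuousLinearMap.mul ℂ (ConfigL2 d ℓ N →L[ℂ] ConfigL2 d ℓ N) (opP i)).comp
      (pairOp i j) (oneE k) = if k = 0 then opP i else 0 := by
    intro k
    rw [ContinuousLinearMap.comp_apply, ContinuousLinearMap.mul_apply', pairOp_oneE hij]
    refine config_clm_ext fun p => ?_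
    simp only [mul_apply_eq_comp, opP_configE]
    split_ifs with h1 h2 h2 <;> simp [mulC_configE, opP_configE, *]
  simp only [h2] at h
  have h3 := h.unique (hasSum_single 0 fun k hk => by simp [hk])
  rw [if_pos rfl, ContinuousLinearMap.comp_apply, ContinuousLinearMap.mul_apply'] at h3
  rw [div_eq_inv_mul, mul_smul, ← h3, smul_smul, inv_mul_cancel₀ volume_ne_zero, one_smul]

/-- `P_i (f(x_i - x_j) F)` is given by the adjoint of `f(x_i - x_j) P_i`, for real `f`. -/
lemma opP_eq_adjoint_pairOp {i j : Fin N} (hij : i ≠ j) {f : Torus d ℓ → ℝ} {fE : OneL2 d ℓ}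
    (hf : (fun x => (f x : ℂ)) =ᵐ[volume] fE) {z F : ConfigL2 d ℓ N}
    (hz : Represents (mulPair f i j F) z) :
    opP i z = ContinuousLinearMap.adjoint (pairOp i j fE) F := by
  refine ext_inner_right ℂ fun G => ?_
  rw [ContinuousLinearMap.adjoint_inner_left, ← adjoint_opP,
    ContinuousLinearMap.adjoint_inner_left, L2.inner_def, L2.inner_def]
  refine integral_congr_ae ?_
  have hA := represents_pairOp hij hf (represents_coe (opP i G))
  filter_upwards [hz, hA] with x h1 h2
  rw [← h1, ← h2]
  simp only [RCLike.inner_apply, mulPair, map_mul, Complex.conj_ofReal]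
  ring

lemma adjoint_pairOp_oneE {i j : Fin N} (hij : i ≠ j) (k : Fin d → ℤ) :
    ContinuousLinearMap.adjoint (pairOp i j (oneE k : OneL2 d ℓ)) =
      opP i * mulC (waveAt j k) * mulC (waveAt i (-k)) := by
  rw [pairOp_oneE hij, ← ContinuousLinearMap.star_eq_adjoint, star_mul, star_mul]
  simp only [ContinuousLinearMap.star_eq_adjoint, adjoint_opP, adjoint_mulC_waveAt, neg_neg,
    mul_assoc]

end PairOperators

/-! ### The kinetic energy -/

section Kinetic

variable {d : ℕ} {ℓ : ℝ} [hℓ : Fact (0 < ℓ)] {N : ℕ}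

omit hℓ in
lemma planeWave_add (k : Fin d → ℤ) (x y : Torus d ℓ) :
    planeWave k (x + y) = planeWave k x * planeWave k y := by
  simp only [planeWave, ← Finset.prod_mul_distrib]
  refine Finset.prod_congr rfl fun α _ => ?_
  rw [Pi.add_apply, fourier_apply, smul_add, AddCircle.toCircle_add, Circle.coe_mul,
    ← fourier_apply, ← fourier_apply]

omit hℓ in
lemma planeWave_single (k : Fin d → ℤ) (α : Fin d) (t : AddCircle ℓ) :
    planeWave k (Pi.single α t) = fourier (k α) t := by
  rw [planeWave, Finset.prod_eq_single α]
  · rw [Pi.single_eq_same]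
  · intro β _ hβ
    rw [Pi.single_eq_of_ne hβ, fourier_eval_zero]
  · simp

omit hℓ in
lemma planeWave_apply_zero (k : Fin d → ℤ) : planeWave k (0 : Torus d ℓ) = 1 := by
  simp [planeWave]

omit hℓ in
lemma configWave_add_single (p : Fin N → Fin d → ℤ) (x : Fin N → Torus d ℓ) (j : Fin N)
    (α : Fin d) (t : AddCircle ℓ) :
    configWave p (x + Pi.single j (Pi.single α t)) = configWave p x * fourier (p j α) t := by
  simp only [configWave, Pi.add_apply, planeWave_add, Finset.prod_mul_distrib]
  congr 1
  rw [Finset.prod_eq_single j]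
  · rw [Pi.single_eq_same, planeWave_single]
  · intro i _ hi
    rw [Pi.single_eq_of_ne hi, planeWave_apply_zero]
  · simp

omit hℓ in
lemma isSmooth_configWave (p : Fin N → Fin d → ℤ) :
    IsSmooth (fun x : Fin N → Torus d ℓ => configWave p x) := by
  unfold IsSmooth
  simp only [configWave, planeWave, fourier_coe_apply]
  refine contDiff_prod fun j _ => contDiff_prod fun α _ => ContDiff.cexp ?_
  refine ContDiff.div_const (ContDiff.mul contDiff_const ?_) _
  exact Complex.ofRealCLM.contDiff.comp
    ((contDiff_apply ℝ ℝ α).comp (contDiff_apply ℝ (Fin d → ℝ) j))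

lemma iteratedDeriv_two_mul_cexp (c a : ℂ) :
    iteratedDeriv 2 (fun t : ℝ => c * Complex.exp (a * t)) 0 = a ^ 2 * c := by
  have h1 : ∀ b : ℂ, deriv (fun t : ℝ => b * Complex.exp (a * t)) =
      fun t : ℝ => (b * a) * Complex.exp (a * t) := by
    intro b
    funext t
    have h : HasDerivAt (fun t : ℝ => b * Complex.exp (a * t))
        (b * (Complex.exp (a * t) * (a * 1))) t :=
      ((((hasDerivAt_id t).ofReal_comp).const_mul a).cexp).const_mul b
    rw [h.deriv]
    ring
  rw [iteratedDeriv_succ, iteratedDeriv_one, h1, h1]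
  simp
  ring

omit hℓ in
lemma smoothLaplacian_configWave (p : Fin N → Fin d → ℤ) (j : Fin N) (x : Fin N → Torus d ℓ) :
    smoothLaplacian j (fun x => configWave p x) x = -(momentumSq ℓ (p j) : ℂ) * configWave p x := by
  simp only [smoothLaplacian, configWave_add_single, fourier_coe_apply]
  have h : ∀ α : Fin d, iteratedDeriv 2 (fun t : ℝ => configWave p x *
      Complex.exp (2 * Real.pi * Complex.I * (p j α) * t / ℓ)) 0 =
      -((2 * Real.pi * p j α / ℓ : ℝ) ^ 2 : ℂ) * configWave p x := by
    intro α
    have := iteratedDeriv_two_mul_cexp (configWave p x)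
      (2 * Real.pi * Complex.I * (p j α) / ℓ)
    simp only [div_mul_eq_mul_div] at this
    rw [this]
    push_cast
    rw [div_pow, div_pow, mul_pow, mul_pow _ Complex.I, Complex.I_sq]
    ring
  rw [Finset.sum_congr rfl fun α _ => h α, ← Finset.sum_mul, momentumSq]
  push_cast
  rw [Finset.sum_neg_distrib]

omit hℓ in
lemma momentumSq_neg (k : Fin d → ℤ) : momentumSq ℓ (-k) = momentumSq ℓ k := by
  simp only [momentumSq, Pi.neg_apply, Int.cast_neg]
  refine Finset.sum_congr rfl fun α _ => ?_
  ring

omit hℓ in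
lemma momentumSq_nonneg (k : Fin d → ℤ) : 0 ≤ momentumSq ℓ k :=
  Finset.sum_nonneg fun _ _ => sq_nonneg _

lemma inner_configE_eq {Ψ : WaveFn d ℓ N} {ψ : ConfigL2 d ℓ N} (h : Represents Ψ ψ)
    (p : Fin N → Fin d → ℤ) : inner ℂ (configE p) ψ = ∫ x, Ψ x * configWave (-p) x := by
  rw [configE, IsCharacterFamily.inner_lp]
  refine integral_congr_ae ?_
  filter_upwards [h] with x hx
  rw [hx]

/-- The kinetic energy acts on Fourier coefficients by multiplication with `∑_j |p_j|²`. -/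
lemma inner_configE_kinetic {Ψ T : WaveFn d ℓ N} (hT : IsKineticImage Ψ T)
    {ψ τ : ConfigL2 d ℓ N} (hψ : Represents Ψ ψ) (hτ : Represents T τ) (p : Fin N → Fin d → ℤ) :
    inner ℂ (configE p) τ = ((∑ j, momentumSq ℓ (p j) : ℝ) : ℂ) * inner ℂ (configE p) ψ := by
  -- The plane wave with momenta -p is the conjugate of the one with momenta p, so testing against
  -- it yields the Fourier coefficient at p.
  have h := hT _ (isSmooth_configWave (-p))
  rw [inner_configE_eq hψ, inner_configE_eq hτ, ← h, ← integral_const_mul]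
  refine integral_congr_ae (Eventually.of_forall fun x => ?_)
  simp only [smoothLaplacian_configWave, Pi.neg_apply, momentumSq_neg, neg_mul, neg_neg]
  rw [← Finset.sum_mul]
  push_cast
  ring

lemma inner_configE_opT (j : Fin N) (k : Fin d → ℤ) (p : Fin N → Fin d → ℤ)
    (ψ : ConfigL2 d ℓ N) :
    inner ℂ (configE p) (opT j k k ψ) = if p j = k then inner ℂ (configE p) ψ else 0 := by
  have key : (innerSL ℂ (configE p : ConfigL2 d ℓ N)).comp (opT j k k) =
      if p j = k then innerSL ℂ (configE p) else 0 := by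
    refine config_clm_ext fun q => ?_
    rw [ContinuousLinearMap.comp_apply, opT_configE]
    by_cases hq : q j = k
    · rw [if_pos hq, ← hq, Function.update_eq_self]
      split_ifs with hp
      · rfl
      · rw [innerSL_apply_apply, inner_configE_configE, if_neg]
        · rfl
        · rintro rfl
          exact hp rfl
    · rw [if_neg hq, map_zero]
      split_ifs with hp
      · rw [innerSL_apply_apply, inner_configE_configE, if_neg]
        rintro rfl
        exact hq hp
      · rfl
  have := congrArg (fun L => L ψ) key
  simp only [ContinuousLinearMap.comp_apply, innerSL_apply_apply] at this
  rw [this]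
  split_ifs <;> rfl

/-- The kinetic energy as the unconditional sum of `k² ∑_j |k⟩⟨k|_j`. -/
lemma hasSum_kinetic {ψ τ : ConfigL2 d ℓ N}
    (h : ∀ p, inner ℂ (configE p) τ =
      ((∑ j, momentumSq ℓ (p j) : ℝ) : ℂ) * inner ℂ (configE p) ψ) :
    HasSum (fun k : Fin d → ℤ => (momentumSq ℓ k : ℂ) • ∑ j, opT j k k ψ) τ := by
  classical
  set V : ℝ := (ℓ ^ d) ^ N with hV
  have hVpos : 0 < V := pow_pos (pow_pos hℓ.out d) N
  set S : Finset (Fin d → ℤ) → ConfigL2 d ℓ N :=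
    fun s => ∑ k ∈ s, (momentumSq ℓ k : ℂ) • ∑ j, opT j k k ψ with hS
  have hpars : ∀ f : ConfigL2 d ℓ N,
      HasSum (fun p => ‖inner ℂ (configE p) f‖ ^ 2) (V * ‖f‖ ^ 2) := by
    intro f
    have h1 := (isCharacterFamily_configWave (d := d) (ℓ := ℓ) (N := N)).hasSum_norm_inner_sq
      (by rw [volume_real_config]; exact hVpos) f
    rw [volume_real_config] at h1
    exact h1
  -- The truncation error at p keeps exactly those particles whose momentum lies outside s.
  have hcoef : ∀ s p, inner ℂ (configE p) (S s - τ) =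
      -(((∑ j, if p j ∈ s then 0 else momentumSq ℓ (p j) : ℝ) : ℂ) * inner ℂ (configE p) ψ) := by
    intro s p
    rw [inner_sub_right, h p, hS]
    simp only [inner_sum, inner_smul_right, inner_configE_opT, Finset.mul_sum, mul_ite, mul_zero]
    rw [Finset.sum_comm]
    push_cast
    rw [Finset.sum_mul, Finset.sum_mul, ← Finset.sum_sub_distrib, ← Finset.sum_neg_distrib]
    refine Finset.sum_congr rfl fun j _ => ?_
    rw [Finset.sum_ite_eq]
    split_ifs <;> simp
  have hlim : Tendsto (fun s => ∑' p, ‖inner ℂ (configE p) (S s - τ)‖ ^ 2) atTop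
      (𝓝 (∑' _ : Fin N → Fin d → ℤ, (0 : ℝ))) := by
    refine tendsto_tsum_of_dominated_convergence (hpars τ).summable ?_ ?_
    · intro p
      refine tendsto_const_nhds.congr' ?_
      -- For fixed p the error vanishes once s contains the finitely many momenta p_j.
      filter_upwards [eventually_ge_atTop (Finset.univ.image p)] with s hs
      have : ∀ j, p j ∈ s := fun j => hs (Finset.mem_image_of_mem p (Finset.mem_univ j))
      rw [hcoef]
      simp [this]
    -- All k² are nonnegative, so the omitted energy is at most the full one; the square-summable
    -- coefficients of τ therefore dominate.
    · refine Eventually.of_forall fun s p => ?_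
      rw [Real.norm_of_nonneg (by positivity), hcoef, h p, norm_neg, norm_mul, norm_mul,
        Complex.norm_real, Complex.norm_real]
      have hle : ∀ j, (if p j ∈ s then 0 else momentumSq ℓ (p j)) ≤ momentumSq ℓ (p j) := fun j => by
        split_ifs
        exacts [momentumSq_nonneg _, le_rfl]
      have hnn : ∀ j, 0 ≤ (if p j ∈ s then 0 else momentumSq ℓ (p j)) := fun j => by
        split_ifs
        exacts [le_rfl, momentumSq_nonneg _]
      rw [Real.norm_of_nonneg (Finset.sum_nonneg fun j _ => hnn j),
        Real.norm_of_nonneg (Finset.sum_nonneg fun j _ => momentumSq_nonneg _)]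
      have hsum := Finset.sum_le_sum fun j (_ : j ∈ Finset.univ) => hle j
      have hsum0 := Finset.sum_nonneg fun j (_ : j ∈ Finset.univ) => hnn j
      gcongr
  rw [tsum_zero] at hlim
  have h2 : Tendsto (fun s => ‖S s - τ‖ ^ 2) atTop (𝓝 0) := by
    have h3 := hlim.const_mul V⁻¹
    rw [mul_zero] at h3
    refine h3.congr fun s => ?_
    rw [(hpars _).tsum_eq, ← mul_assoc, inv_mul_cancel₀ hVpos.ne', one_mul]
  refine tendsto_iff_norm_sub_tendsto_zero.2 ?_
  have h4 : Tendsto (fun s => ‖S s - τ‖) atTop (𝓝 0) := by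
    simpa [Real.sqrt_sq] using h2.sqrt
  exact h4

end Kinetic

/-! ### Second quantized operators on a sector -/

section SecondQuantization

variable {d : ℕ} {ℓ : ℝ} [hℓ : Fact (0 < ℓ)] {N : ℕ}

lemma Represents.opT {Ψ : WaveFn d ℓ N} {ψ : ConfigL2 d ℓ N} (h : Represents Ψ ψ) (i : Fin N)
    (a b : Fin d → ℤ) :
    Represents (fun x => planeWave a (x i) * DiluteBose.projP i
      (fun x => planeWave (-b) (x i) * Ψ x) x) (opT i a b ψ) :=
  ((h.mulC (waveAt i (-b))).projP i).mulC (waveAt i a)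

omit hℓ in
lemma sqrt_volume_mul (hℓ : 0 < ℓ) (m : ℕ) :
    ((Real.sqrt (m + 1))⁻¹ : ℂ) * ((Real.sqrt (ℓ ^ d))⁻¹ : ℂ) *
      ((Real.sqrt (m + 1) : ℂ) * ((Real.sqrt (ℓ ^ d))⁻¹ : ℂ)) = ((ℓ ^ d : ℝ) : ℂ)⁻¹ := by
  have h1 : (Real.sqrt (m + 1) : ℂ) ≠ 0 := by
    exact_mod_cast (Real.sqrt_pos.2 (by positivity : (0 : ℝ) < m + 1)).ne'
  have h2 : ((ℓ ^ d : ℝ) : ℂ) = (Real.sqrt (ℓ ^ d) : ℂ) * (Real.sqrt (ℓ ^ d) : ℂ) := by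
    rw [← Complex.ofReal_mul, Real.mul_self_sqrt (pow_pos hℓ d).le]
  rw [h2, mul_inv]
  field_simp

/-- A bosonic wave function does not see the order of its arguments. -/
lemma IsBosonic.ae_comp {Ψ : WaveFn d ℓ N} (hΨ : IsBosonic Ψ) :
    ∀ᵐ x : Fin N → Torus d ℓ, ∀ σ : Equiv.Perm (Fin N), Ψ (x ∘ σ) = Ψ x :=
  ae_all_iff.2 fun σ => hΨ.2 σ

-- Annihilation inserts its variable in front, while P_j acts in slot j. The two arguments differ by
-- a permutation, which a bosonic function does not see.
omit hℓ in
lemma cons_succAbove_eq {n : ℕ} (x : Fin (n + 1) → Torus d ℓ) (j : Fin (n + 1)) (y : Torus d ℓ) :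
    (Fin.cons y fun i => x (j.succAbove i) : Fin (n + 1) → Torus d ℓ) =
      Function.update x j y ∘ j.cycleRange.symm := by
  funext i
  refine Fin.cases ?_ (fun i => ?_) i
  · simp
  · simp [Fin.succAbove_ne]

omit hℓ in
lemma cons_cons_succAbove_eq {n : ℕ} (x : Fin (n + 2) → Torus d ℓ) (i : Fin (n + 2))
    (j : Fin (n + 1)) (y z : Torus d ℓ) :
    ∃ σ : Equiv.Perm (Fin (n + 2)),
      (Fin.cons z (Fin.cons y fun k => x (i.succAbove (j.succAbove k)) :
        Fin (n + 1) → Torus d ℓ) : Fin (n + 2) → Torus d ℓ) =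
      Function.update (Function.update x i y) (i.succAbove j) z ∘ σ := by
  -- The order in which two annihilations list the slots: the one removed second, then i, then the
  -- untouched ones.
  set s : Fin (n + 2) → Fin (n + 2) := Fin.cons (i.succAbove j)
    (Fin.cons i fun k => i.succAbove (j.succAbove k) : Fin (n + 1) → Fin (n + 2)) with hs
  have hinj : Function.Injective s := by
    rw [hs, Fin.cons_injective_iff, Fin.cons_injective_iff]
    refine ⟨?_, ?_, ?_⟩
    · rintro ⟨k, hk⟩
      refine Fin.cases ?_ (fun k hk => ?_) k hk
      · intro h
        exact Fin.succAbove_ne i j h.symm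
      · rw [Fin.cons_succ] at hk
        exact Fin.succAbove_ne j k (Fin.succAbove_right_injective hk)
    · rintro ⟨k, hk⟩
      exact Fin.succAbove_ne i _ hk
    · exact Fin.succAbove_right_injective.comp Fin.succAbove_right_injective
  refine ⟨Equiv.ofBijective s (Finite.injective_iff_bijective.1 hinj), ?_⟩
  funext k
  refine Fin.cases ?_ (fun k => Fin.cases ?_ (fun k => ?_) k) k
  · simp [hs]
  · simp [hs, (Fin.succAbove_ne i j).symm]
  · simp [hs, Fin.succAbove_ne, Fin.succAbove_right_injective.ne_iff]

/-- Symmetry moves the annihilated variable into the slot that creation refills; the square roots in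
the definitions cancel, leaving the factor |Λ|⁻¹ of the rank-one operator. -/
lemma represents_cre_ann {Ψ : WaveFn d ℓ N} (hΨ : IsBosonic Ψ) {ψ : ConfigL2 d ℓ N}
    (hψ : Represents Ψ ψ) (k : Fin d → ℤ) :
    Represents (onSector (fun Φ => cre k (ann k Φ)) Ψ) (∑ j, opT j k k ψ) := by
  refine (Represents.sum Finset.univ fun j _ => hψ.opT j k k).congr ?_
  obtain _ | n := N
  · refine Eventually.of_forall fun x => ?_
    simp [onSector, cre]
  · have h := fun j => ae_ae_update hΨ.ae_comp j
    filter_upwards [ae_all_iff.2 h] with x hx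
    simp only [onSector, cre, ann, Pi.single_eq_same, Finset.sum_apply, projP,
      Function.update_self, Finset.mul_sum]
    refine Finset.sum_congr rfl fun j _ => ?_
    rw [← sqrt_volume_mul hℓ.out n]
    have : ∫ y : Torus d ℓ, starRingEnd ℂ (planeWave k y) *
          Ψ (Fin.cons y fun i => x (j.succAbove i)) =
        ∫ y : Torus d ℓ, planeWave (-k) y * Ψ (Function.update x j y) := by
      refine integral_congr_ae ?_
      filter_upwards [hx j] with y hy
      rw [cons_succAbove_eq, hy, isCharacterFamily_planeWave.map_neg]
    rw [this]
    ring

omit hℓ in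
lemma sum_filter_ne_eq_sum_succAbove {M : Type*} [AddCommMonoid M] {n : ℕ} (i : Fin (n + 1))
    (f : Fin (n + 1) → M) :
    ∑ j ∈ Finset.univ.filter (fun j => i ≠ j), f j = ∑ j : Fin n, f (i.succAbove j) := by
  rw [Finset.sum_filter, Fin.sum_univ_succAbove _ i]
  simp [(Fin.succAbove_ne i _).symm]

/-- The two creations fill distinct slots i ≠ j, and by symmetry the two annihilations may be taken
in those same slots. -/
lemma represents_cre_cre_ann_ann {Ψ : WaveFn d ℓ N} (hΨ : IsBosonic Ψ) {ψ : ConfigL2 d ℓ N}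
    (hψ : Represents Ψ ψ) (a b c e : Fin d → ℤ) :
    Represents (onSector (fun Φ => cre a (cre b (ann c (ann e Φ)))) Ψ)
      (∑ i, ∑ j ∈ Finset.univ.filter (fun j => i ≠ j), opT i a c (opT j b e ψ)) := by
  refine (Represents.sum Finset.univ fun i _ => Represents.sum _ fun j _ =>
    (hψ.opT j b e).opT i a c).congr ?_
  obtain _ | _ | n := N
  -- With fewer than two particles, two creations cannot end in the sector and there is no pair i ≠
  -- j: both sides vanish.
  · refine Eventually.of_forall fun x => ?_
    simp [onSector, cre]
  · refine Eventually.of_forall fun x => ?_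
    simp [onSector, cre, Subsingleton.elim _ (0 : Fin 1)]
  · have h := fun (i : Fin (n + 2)) (j : Fin (n + 1)) =>
      ae_ae_update (ae_ae_update hΨ.ae_comp (i.succAbove j)) i
    filter_upwards [ae_all_iff.2 fun i => ae_all_iff.2 (h i)] with x hx
    simp only [sum_filter_ne_eq_sum_succAbove]
    simp only [onSector, cre, ann, Pi.single_eq_same, Finset.sum_apply, projP,
      Function.update_self, Function.update_of_ne (Fin.succAbove_ne _ _), Finset.mul_sum]
    refine Finset.sum_congr rfl fun i _ => Finset.sum_congr rfl fun j _ => ?_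
    have hi : ∫ y : Torus d ℓ, starRingEnd ℂ (planeWave c y) *
          ((Real.sqrt (((n + 1 : ℕ) : ℝ) + 1) : ℂ) * ((Real.sqrt (ℓ ^ d))⁻¹ : ℂ) *
            ∫ z : Torus d ℓ, starRingEnd ℂ (planeWave e z) *
              Ψ (Fin.cons z (Fin.cons y fun k => x (i.succAbove (j.succAbove k)) :
                Fin (n + 1) → Torus d ℓ))) =
        ((Real.sqrt (((n + 1 : ℕ) : ℝ) + 1) : ℂ) * ((Real.sqrt (ℓ ^ d))⁻¹ : ℂ)) *
        ∫ y : Torus d ℓ, planeWave (-c) y *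
          ∫ z : Torus d ℓ, planeWave (-e) z *
            Ψ (Function.update (Function.update x i y) (i.succAbove j) z) := by
      rw [← integral_const_mul]
      refine integral_congr_ae ?_
      filter_upwards [hx i j] with y hy
      have hz : ∫ z : Torus d ℓ, starRingEnd ℂ (planeWave e z) *
              Ψ (Fin.cons z (Fin.cons y fun k => x (i.succAbove (j.succAbove k)) :
                Fin (n + 1) → Torus d ℓ)) = ∫ z : Torus d ℓ, planeWave (-e) z *
            Ψ (Function.update (Function.update x i y) (i.succAbove j) z) := by
        refine integral_congr_ae ?_
        filter_upwards [hy] with z hz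
        obtain ⟨σ, hσ⟩ := cons_cons_succAbove_eq x i j y z
        rw [hσ, hz, isCharacterFamily_planeWave.map_neg]
      rw [hz, isCharacterFamily_planeWave.map_neg]
      ring
    rw [hi]
    have hr : ∫ y : Torus d ℓ, planeWave (-c) y * (planeWave b (x (i.succAbove j)) *
          (((ℓ ^ d : ℝ) : ℂ)⁻¹ * ∫ z : Torus d ℓ, planeWave (-e) z *
            Ψ (Function.update (Function.update x i y) (i.succAbove j) z))) =
        planeWave b (x (i.succAbove j)) * ((ℓ ^ d : ℝ) : ℂ)⁻¹ *
        ∫ y : Torus d ℓ, planeWave (-c) y *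
          ∫ z : Torus d ℓ, planeWave (-e) z *
            Ψ (Function.update (Function.update x i y) (i.succAbove j) z) := by
      rw [← integral_const_mul]
      refine integral_congr_ae (Eventually.of_forall fun y => ?_)
      simp only
      ring
    rw [hr]
    nth_rewrite 1 [← sqrt_volume_mul hℓ.out n]
    rw [← sqrt_volume_mul hℓ.out (n + 1)]
    ring

end SecondQuantization

/-! ### Decomposition of the pair interaction -/

section Decomposition

variable {d : ℕ} {ℓ : ℝ} [hℓ : Fact (0 < ℓ)] {N : ℕ}

lemma opP_opP (i : Fin N) (x : ConfigL2 d ℓ N) : opP i (opP i x) = opP i x :=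
  congrArg (fun L => L x) (opP_comp_self i)

lemma opP_opP_comm (i j : Fin N) (x : ConfigL2 d ℓ N) : opP i (opP j x) = opP j (opP i x) :=
  congrArg (fun L => L x) (opP_comm i j)

lemma opP_pairOp {i j : Fin N} (hij : i ≠ j) (f : OneL2 d ℓ) (x : ConfigL2 d ℓ N) :
    opP i (pairOp i j f x) = (oneHat f 0 / ((ℓ ^ d : ℝ) : ℂ)) • opP i x :=
  congrArg (fun L => L x) (opP_mul_pairOp hij f)

/-- The function `f` on the torus is even. -/
def IsEven (f : Torus d ℓ → ℝ) : Prop := ∀ x, f (-x) = f x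

omit hℓ in
lemma mulPair_swap {f : Torus d ℓ → ℝ} (hf : IsEven f) (i j : Fin N) (Ψ : WaveFn d ℓ N) :
    mulPair f i j Ψ = mulPair f j i Ψ := by
  funext x
  rw [mulPair, mulPair, ← hf (x i - x j), neg_sub]

/-- Both sides are f(x_i - x_j)P_iP_j, because f is even and the projections commute. -/
lemma pairOp_opP_swap {i j : Fin N} (hij : i ≠ j) {f : Torus d ℓ → ℝ} (hf : IsEven f)
    {fE : OneL2 d ℓ} (hfE : (fun x => (f x : ℂ)) =ᵐ[volume] fE) (x : ConfigL2 d ℓ N) :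
    pairOp i j fE (opP j x) = pairOp j i fE (opP i x) := by
  have h1 := represents_pairOp hij hfE (represents_coe (opP i (opP j x)))
  have h2 := represents_pairOp hij.symm hfE (represents_coe (opP j (opP i x)))
  refine h1.eq_of_ae h2 ?_
  rw [opP_opP_comm]
  exact EventuallyEq.of_eq (mulPair_swap hf i j _)

/-- This is Π f Π, with the right factor written as Π = P_i + P_jQ_i. Whenever the same particle is
projected by P on both sides of f, `opP_pairOp` replaces f by c; only the terms exchanging a
condensate and an excited particle keep f. -/
lemma pairOp_momentum_conservation {i j : Fin N} (hij : i ≠ j) {f : OneL2 d ℓ}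
    (hf : ∀ x : ConfigL2 d ℓ N, pairOp i j f (opP j x) = pairOp j i f (opP i x))
    {c : ℂ} (hc : c = oneHat f 0 / ((ℓ ^ d : ℝ) : ℂ)) (x : ConfigL2 d ℓ N) :
    opP i (opP j (pairOp i j f x + pairOp j i f (opQ i x))) +
        opP i (opQ j (pairOp i j f x + pairOp j i f (opQ i x))) +
        opQ i (opP j (pairOp i j f x + pairOp j i f (opQ i x))) =
      c • opP i (opP j x) + c • opP i (opQ j x) + c • opP j (opQ i x) +
        opP j (pairOp i j f (opQ j x)) + opP i (pairOp j i f (opQ i x)) := by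
  have f1 : ∀ y : ConfigL2 d ℓ N, opP i (pairOp i j f y) = c • opP i y := fun y => by
    rw [hc, opP_pairOp hij]
  have f2 : ∀ y : ConfigL2 d ℓ N, opP j (pairOp j i f y) = c • opP j y := fun y => by
    rw [hc, opP_pairOp hij.symm]
  have k1 : ∀ y : ConfigL2 d ℓ N, opP i (opP j (pairOp i j f y)) = c • opP j (opP i y) :=
    fun y => by rw [opP_opP_comm, f1, map_smul]
  simp only [opQ_apply, map_sub, map_add, hf, k1, f1, f2, map_smul]
  simp only [opP_opP_comm i j, opP_opP]
  module

/-- Here w stands for vψ, Ω for multiplication by ω, θ for (v - gΠ)ψ, z for g Q_jQ_iψ and f for g +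
gω. Since Q_iQ_j = 1 - Π, the 𝒬₄ part is θ - Π(1 - Ω)θ = w - gΠψ - Πz - ΠΩgΠψ. Splitting gΠψ into
Q_iQ_j gΠψ and Π gΠψ leaves Π f Πψ, handled by momentum conservation. -/
lemma pair_decomposition {i j : Fin N} (hij : i ≠ j) {g f : OneL2 d ℓ}
    (hf : ∀ x : ConfigL2 d ℓ N, pairOp i j f (opP j x) = pairOp j i f (opP i x))
    {c : ℂ} (hc : c = oneHat f 0 / ((ℓ ^ d : ℝ) : ℂ))
    {Ω : ConfigL2 d ℓ N →L[ℂ] ConfigL2 d ℓ N}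
    (h1 : ∀ x, pairOp i j f x = pairOp i j g x + Ω (pairOp i j g x))
    (h2 : ∀ x, pairOp j i f x = pairOp j i g x + Ω (pairOp j i g x))
    {w ψ z θ : ConfigL2 d ℓ N}
    (hθ : θ = w - (pairOp i j g ψ + pairOp j i g (opQ i ψ)))
    (hz : z = w - Ω w - (pairOp i j g ψ + pairOp j i g (opQ i ψ))) :
    w = (opQ i (opQ j θ) + (opP i (opP j (Ω θ)) + opP i (opQ j (Ω θ)) + opQ i (opP j (Ω θ)))) +
      opP j (opP i z) + (opP i (opQ j z) + opQ i (opQ j (pairOp i j g (opQ j ψ)))) +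
      (opP j (opQ i z) + opQ j (opQ i (pairOp j i g (opQ i ψ)))) +
      opQ i (opQ j (pairOp i j g (opP j ψ))) +
      c • opP i (opP j ψ) + c • opP i (opQ j ψ) + c • opP j (opQ i ψ) +
      opP j (pairOp i j f (opQ j ψ)) + opP i (pairOp j i f (opQ i ψ)) := by
  have key := pairOp_momentum_conservation hij hf hc ψ
  -- Splitting P_i into P_iP_j + P_iQ_j separates pair creation from the 𝒬₃ contribution.
  have hR : pairOp i j g ψ = pairOp i j g (opP j ψ) + pairOp i j g (opQ j ψ) := by
    rw [← map_add, opQ_apply, add_sub_cancel]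
  set a := pairOp i j g (opP j ψ)
  set b := pairOp i j g (opQ j ψ)
  set e := pairOp j i g (opQ i ψ)
  set X := c • opP i (opP j ψ) + c • opP i (opQ j ψ) + c • opP j (opQ i ψ) +
      opP j (pairOp i j f (opQ j ψ)) + opP i (pairOp j i f (opQ i ψ)) with hX
  have he : pairOp j i g (opQ i ψ) = e := rfl
  rw [h1, h2, hR, he] at key
  clear_value e
  rw [hR] at hθ hz
  have goal : w = (opQ i (opQ j θ) + (opP i (opP j (Ω θ)) + opP i (opQ j (Ω θ)) +
      opQ i (opP j (Ω θ)))) + opP j (opP i z) + (opP i (opQ j z) + opQ i (opQ j b)) +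
      (opP j (opQ i z) + opQ j (opQ i e)) + opQ i (opQ j a) + X := by
    rw [← key, hθ, hz]
    simp only [opQ_apply, map_sub, map_add, opP_opP_comm i j]
    abel
  calc w = _ := goal
    _ = _ := by rw [hX]; abel

lemma opQ_configE (i : Fin N) (p : Fin N → Fin d → ℤ) :
    opQ i (configE p : ConfigL2 d ℓ N) = if p i = 0 then 0 else configE p := by
  rw [opQ_apply, opP_configE]
  split_ifs <;> simp

omit hℓ in
lemma update_update_eq_add {i j : Fin N} (hij : i ≠ j) (p : Fin N → Fin d → ℤ)
    (a b : Fin d → ℤ) :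
    Function.update (Function.update p j (p j + b)) i (p i + a) =
      p + Pi.single i a + Pi.single j b := by
  funext m
  by_cases hi : m = i
  · subst hi; simp [hij]
  · by_cases hj : m = j
    · subst hj; simp [hi]
    · simp [hi, hj]

-- The adjoint shifts the momenta of i and j by -k and k, and zero final momenta force the initial
-- ones to be (k, -k). The factors Q_iQ_j exclude k = 0. The next two lemmas follow the same
-- bookkeeping for creation and exchange.
set_option linter.unusedSimpArgs false in
lemma opT_opT_annihilate_pair {i j : Fin N} (hij : i ≠ j) {k : Fin d → ℤ} (x : ConfigL2 d ℓ N) :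
    opP j (ContinuousLinearMap.adjoint (pairOp i j (oneE k)) (opQ j (opQ i x))) =
      if k = 0 then 0 else opT i 0 k (opT j 0 (-k) x) := by
  have : (opP j : ConfigL2 d ℓ N →L[ℂ] _) *
      (ContinuousLinearMap.adjoint (pairOp i j (oneE k)) * (opQ j * opQ i)) =
      if k = 0 then 0 else opT i 0 k * opT j 0 (-k) := by
    rw [adjoint_pairOp_oneE hij]
    refine config_clm_ext fun p => ?_
    by_cases hk : k = 0
    · subst hk
      by_cases hi : p i = 0 <;> by_cases hj : p j = 0 <;> simp [mul_apply_eq_comp, opQ_configE, opP_configE, mulC_configE, hi, hj]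
    by_cases hi : p i = k
    · by_cases hj : p j = -k
      · have hu := update_update_eq_add hij p (-k) k
        rw [hi, hj, add_neg_cancel, neg_add_cancel] at hu
        simp [mul_apply_eq_comp, opQ_configE, opP_configE, mulC_configE, opT_configE, hij, hij.symm, hi, hj, hk, hu]
      · have hj' : p j + k ≠ 0 := fun h => hj (eq_neg_of_add_eq_zero_left h)
        by_cases hj0 : p j = 0 <;> simp [mul_apply_eq_comp, opQ_configE, opP_configE, mulC_configE, opT_configE, hij, hij.symm, hi, hj, hk, hj', hj0]
    · have hi' : p i + -k ≠ 0 := fun h => hi (add_neg_eq_zero.1 h)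
      by_cases hi0 : p i = 0 <;> by_cases hj0 : p j = 0 <;> by_cases hj : p j = -k <;>
        simp [mul_apply_eq_comp, opQ_configE, opP_configE, mulC_configE, opT_configE, hij, hij.symm, hi, hk, Ne.symm hk, hi', hi0, hj0, hj]
  have h := congrArg (fun L => L x) this
  simp only [mul_apply_eq_comp] at h
  rw [h]
  split_ifs <;> rfl

set_option linter.unusedSimpArgs false in
lemma opT_opT_create_pair {i j : Fin N} (hij : i ≠ j) {k : Fin d → ℤ} (x : ConfigL2 d ℓ N) :
    opQ i (opQ j (pairOp j i (oneE k) (opP i x))) =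
      if k = 0 then 0 else opT i (-k) 0 (opT j k 0 x) := by
  have : (opQ i : ConfigL2 d ℓ N →L[ℂ] _) * (opQ j * (pairOp j i (oneE k) * opP i)) =
      if k = 0 then 0 else opT i (-k) 0 * opT j k 0 := by
    rw [pairOp_oneE hij.symm]
    refine config_clm_ext fun p => ?_
    by_cases hk : k = 0
    · subst hk
      by_cases hi : p i = 0 <;> by_cases hj : p j = 0 <;> simp [mul_apply_eq_comp, opQ_configE, opP_configE, mulC_configE, hi, hj]
    by_cases hi : p i = 0
    · by_cases hj : p j = 0
      · have hu := update_update_eq_add hij p (-k) k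
        rw [hi, hj, zero_add, zero_add] at hu
        simp [mul_apply_eq_comp, opQ_configE, opP_configE, mulC_configE, opT_configE, hij, hij.symm, hi, hj, hk, hu]
      · simp [mul_apply_eq_comp, opQ_configE, opP_configE, mulC_configE, opT_configE, hij, hij.symm, hi, hj, hk]
    · by_cases hj : p j = 0 <;> simp [mul_apply_eq_comp, opQ_configE, opP_configE, mulC_configE, opT_configE, hij, hij.symm, hi, hk, hj]
  have h := congrArg (fun L => L x) this
  simp only [mul_apply_eq_comp] at h
  rw [h]
  split_ifs <;> rfl

set_option linter.unusedSimpArgs false in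
lemma opT_opT_exchange {i j : Fin N} (hij : i ≠ j) {k : Fin d → ℤ} (x : ConfigL2 d ℓ N) :
    opP i (pairOp j i (oneE k) (opQ i x)) =
      if k = 0 then 0 else opT i 0 k (opT j k 0 x) := by
  have : (opP i : ConfigL2 d ℓ N →L[ℂ] _) * (pairOp j i (oneE k) * opQ i) =
      if k = 0 then 0 else opT i 0 k * opT j k 0 := by
    rw [pairOp_oneE hij.symm]
    refine config_clm_ext fun p => ?_
    by_cases hk : k = 0
    · subst hk
      by_cases hi : p i = 0 <;> by_cases hj : p j = 0 <;> simp [mul_apply_eq_comp, opQ_configE, opP_configE, mulC_configE, hi, hj]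
    by_cases hi : p i = k
    · by_cases hj : p j = 0
      · have hu := update_update_eq_add hij p (-k) k
        rw [hi, hj, add_neg_cancel, zero_add] at hu
        simp [mul_apply_eq_comp, opQ_configE, opP_configE, mulC_configE, opT_configE, hij, hij.symm, hi, hj, hk, hu]
      · simp [mul_apply_eq_comp, opQ_configE, opP_configE, mulC_configE, opT_configE, hij, hij.symm, hi, hj, hk]
    · have hi' : p i + -k ≠ 0 := fun h => hi (add_neg_eq_zero.1 h)
      by_cases hi0 : p i = 0 <;> by_cases hj : p j = 0 <;> simp [mul_apply_eq_comp, opQ_configE, opP_configE, mulC_configE, opT_configE, hij, hij.symm, hi, hk, Ne.symm hk, hi', hi0, hj]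
  have h := congrArg (fun L => L x) this
  simp only [mul_apply_eq_comp] at h
  rw [h]
  split_ifs <;> rfl

end Decomposition

/-! ### Momentum expansions of the pair operators -/

section Expansion

variable {d : ℕ} {ℓ : ℝ} [hℓ : Fact (0 < ℓ)] {N : ℕ}

lemma hasSum_exchange {i j : Fin N} (hij : i ≠ j) (f : OneL2 d ℓ) (ψ : ConfigL2 d ℓ N) :
    HasSum (fun k : {k : Fin d → ℤ // k ≠ 0} => oneHat f k • opT i 0 k (opT j k 0 ψ))
      (((ℓ ^ d : ℝ) : ℂ) • opP i (pairOp j i f (opQ i ψ))) := by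
  have h := hasSum_ne_zero ((opP i).comp
    ((ContinuousLinearMap.apply ℂ (ConfigL2 d ℓ N) (opQ i ψ)).comp (pairOp j i)))
    (by simpa using opT_opT_exchange hij (k := 0) ψ) f
  convert! h using 2 with k
  have h2 := opT_opT_exchange hij (k := (k : Fin d → ℤ)) ψ
  rw [if_neg k.2] at h2
  rw [← h2]
  rfl

lemma hasSum_create_pair {i j : Fin N} (hij : i ≠ j) (f : OneL2 d ℓ) (ψ : ConfigL2 d ℓ N) :
    HasSum (fun k : {k : Fin d → ℤ // k ≠ 0} => oneHat f k • opT i (-(k : Fin d → ℤ)) 0 (opT j k 0 ψ))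
      (((ℓ ^ d : ℝ) : ℂ) • opQ i (opQ j (pairOp j i f (opP i ψ)))) := by
  have h := hasSum_ne_zero ((opQ i).comp ((opQ j).comp
    ((ContinuousLinearMap.apply ℂ (ConfigL2 d ℓ N) (opP i ψ)).comp (pairOp j i))))
    (by simpa using opT_opT_create_pair hij (k := 0) ψ) f
  convert! h using 2 with k
  have h2 := opT_opT_create_pair hij (k := (k : Fin d → ℤ)) ψ
  rw [if_neg k.2] at h2
  rw [← h2]
  rfl

/-- Here g stands to the right of the projection, so the expansion goes through the adjoint. Taking
adjoints conjugates the Fourier coefficients, which the reality assumption makes harmless. -/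
lemma hasSum_annihilate_pair {i j : Fin N} (hij : i ≠ j) {f : OneL2 d ℓ}
    (hf : ∀ k, starRingEnd ℂ (oneHat f k) = oneHat f k) (ψ : ConfigL2 d ℓ N) :
    HasSum (fun k : {k : Fin d → ℤ // k ≠ 0} => oneHat f k • opT i 0 k (opT j 0 (-(k : Fin d → ℤ)) ψ))
      (((ℓ ^ d : ℝ) : ℂ) •
        opP j (ContinuousLinearMap.adjoint (pairOp i j f) (opQ j (opQ i ψ)))) := by
  have h := ((opP j).comp (ContinuousLinearMap.apply ℂ (ConfigL2 d ℓ N)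
    (opQ j (opQ i ψ)))).hasSum (hasSum_oneHat_smul (pairOp i j : OneL2 d ℓ →L[ℂ] _) f).star
  have h2 := (hasSum_subtype_iff_of_support_subset (s := {k : Fin d → ℤ | k ≠ 0}) (by
    intro k hk h0
    subst h0
    refine hk ?_
    have h3 := opT_opT_annihilate_pair hij (k := 0) ψ
    rw [if_pos rfl] at h3
    simp only [star_smul, map_smul, ContinuousLinearMap.comp_apply,
      ContinuousLinearMap.apply_apply, ContinuousLinearMap.star_eq_adjoint]
    rw [h3, smul_zero])).2 h
  convert! h2 using 1
  · funext k
    have h3 := opT_opT_annihilate_pair hij (k := (k : Fin d → ℤ)) ψ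
    rw [if_neg k.2] at h3
    rw [← h3]
    simp only [Function.comp_apply, star_smul, map_smul, ContinuousLinearMap.comp_apply,
      ContinuousLinearMap.apply_apply, ContinuousLinearMap.star_eq_adjoint]
    rw [← starRingEnd_apply, hf]
  · simp only [star_smul, map_smul, ContinuousLinearMap.comp_apply,
      ContinuousLinearMap.apply_apply, ContinuousLinearMap.star_eq_adjoint]
    rw [← starRingEnd_apply, Complex.conj_ofReal]

/-- Conjugating the plane wave amounts to reflecting x, which preserves both f and the measure. -/
lemma conj_fourierHat_of_isEven {f : Torus d ℓ → ℝ} (hf : IsEven f) (k : Fin d → ℤ) :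
    starRingEnd ℂ (fourierHat f k) = fourierHat f k := by
  have h1 : ∀ x : Torus d ℓ, starRingEnd ℂ (planeWave (-k) x) = planeWave (-k) (-x) := by
    intro x
    have h2 := planeWave_sub (-k) (0 : Torus d ℓ) x
    rw [zero_sub, planeWave_apply_zero, one_mul] at h2
    rw [h2, ← isCharacterFamily_planeWave.map_neg]
  rw [fourierHat, ← integral_conj]
  simp only [map_mul, Complex.conj_ofReal, h1]
  have : (volume : Measure (Torus d ℓ)).IsNegInvariant :=
    Measure.IsAddHaarMeasure.isNegInvariant_of_regular _
  rw [← integral_neg_eq_self (μ := (volume : Measure (Torus d ℓ)))]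
  refine integral_congr_ae (Eventually.of_forall fun x => ?_)
  simp only [hf x, neg_neg]

end Expansion

/-! ### Sums over ordered pairs of particles -/

section PairSums

variable {N : ℕ} {M : Type*} [AddCommGroup M]

/-- The sum over ordered pairs of distinct indices. -/
def pairSum (F : Fin N → Fin N → M) : M :=
  ∑ i, ∑ j ∈ Finset.univ.filter (fun j => i ≠ j), F i j

lemma pairSum_swap (F : Fin N → Fin N → M) : pairSum F = pairSum fun i j => F j i := by
  simp only [pairSum, Finset.sum_filter]
  rw [Finset.sum_comm]
  simp only [ne_comm]

lemma pairSum_congr {F G : Fin N → Fin N → M} (h : ∀ i j, i ≠ j → F i j = G i j) :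
    pairSum F = pairSum G :=
  Finset.sum_congr rfl fun i _ => Finset.sum_congr rfl fun j hj => h i j (Finset.mem_filter.1 hj).2

lemma pairSum_add (F G : Fin N → Fin N → M) :
    (pairSum fun i j => F i j + G i j) = pairSum F + pairSum G := by
  simp only [pairSum, Finset.sum_add_distrib]

lemma pairSum_smul [Module ℂ M] (c : ℂ) (F : Fin N → Fin N → M) :
    (pairSum fun i j => c • F i j) = c • pairSum F := by
  simp only [pairSum, Finset.smul_sum]

lemma pairSum_eq_add_of_symm {F : Fin N → Fin N → M} (h : ∀ i j, i ≠ j → F i j = F j i) :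
    pairSum F = ∑ i, ∑ j ∈ Finset.univ.filter (fun j => i < j), F i j +
      ∑ i, ∑ j ∈ Finset.univ.filter (fun j => i < j), F i j := by
  have h1 : pairSum F = ∑ i, ∑ j ∈ Finset.univ.filter (fun j => i < j), F i j +
      ∑ i, ∑ j ∈ Finset.univ.filter (fun j => j < i), F i j := by
    rw [pairSum, ← Finset.sum_add_distrib]
    refine Finset.sum_congr rfl fun i _ => ?_
    rw [← Finset.sum_union]
    · refine Finset.sum_congr ?_ fun _ _ => rfl
      ext j
      simp [lt_or_lt_iff_ne]
    · rw [Finset.disjoint_filter]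
      exact fun j _ h1 h2 => lt_asymm h1 h2
  rw [h1]
  congr 1
  simp only [Finset.sum_filter]
  rw [Finset.sum_comm]
  refine Finset.sum_congr rfl fun i _ => Finset.sum_congr rfl fun j _ => ?_
  split_ifs with hij
  · exact h j i hij.ne'
  · rfl

lemma HasSum.pairSum {ι : Type*} [TopologicalSpace M] [ContinuousAdd M]
    {F : Fin N → Fin N → ι → M} {G : Fin N → Fin N → M}
    (h : ∀ i j, i ≠ j → HasSum (F i j) (G i j)) :
    HasSum (fun k => pairSum fun i j => F i j k) (pairSum G) :=
  hasSum_sum fun i _ => hasSum_sum fun j hj => h i j (Finset.mem_filter.1 hj).2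

end PairSums

/-! ### The Hamiltonian -/

section Hamiltonian

variable {d : ℕ} {ℓ : ℝ} [hℓ : Fact (0 < ℓ)] {N : ℕ}

-- Nonnegative pair potentials cannot cancel one another, so each pair term is bounded pointwise by
-- the total.
omit hℓ in
lemma norm_mulPair_le_norm_potentialEnergy {v : Torus d ℓ → ℝ} (hv : ∀ x, 0 ≤ v x)
    {i j : Fin N} (hij : i < j) (Ψ : WaveFn d ℓ N) (x : Fin N → Torus d ℓ) :
    ‖mulPair v i j Ψ x‖ ≤ ‖potentialEnergy v Ψ x‖ := by
  have h1 : potentialEnergy v Ψ x =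
      ((∑ i, ∑ j ∈ Finset.univ.filter (fun j => i < j), v (x i - x j) : ℝ) : ℂ) * Ψ x := by
    simp only [potentialEnergy, Finset.sum_apply, mulPair]
    push_cast
    simp only [Finset.sum_mul]
  have hin : ∀ i, 0 ≤ ∑ j ∈ Finset.univ.filter (fun j => i < j), v (x i - x j) :=
    fun i => Finset.sum_nonneg fun j _ => hv _
  rw [h1, mulPair, norm_mul, norm_mul, Complex.norm_real, Complex.norm_real,
    Real.norm_of_nonneg (hv _), Real.norm_of_nonneg (Finset.sum_nonneg fun i _ => hin i)]
  gcongr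
  calc v (x i - x j) ≤ ∑ j ∈ Finset.univ.filter (fun j => i < j), v (x i - x j) :=
        Finset.single_le_sum (f := fun j => v (x i - x j)) (fun j _ => hv _) (by simp [hij])
    _ ≤ _ := Finset.single_le_sum (f := fun i =>
        ∑ j ∈ Finset.univ.filter (fun j => i < j), v (x i - x j)) (fun i _ => hin i)
        (Finset.mem_univ i)

lemma memLp_mulPair {v : Torus d ℓ → ℝ} (hv : ∀ x, 0 ≤ v x) (hve : IsEven v)
    (hvm : AEStronglyMeasurable v volume) {Ψ : WaveFn d ℓ N} (hΨ : MemLp Ψ 2 volume)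
    (hpot : MemLp (potentialEnergy v Ψ) 2 volume) {i j : Fin N} (hij : i ≠ j) :
    MemLp (mulPair v i j Ψ) 2 volume := by
  wlog h : i < j generalizing i j
  · rw [mulPair_swap hve]
    exact this hij.symm (lt_of_le_of_ne (not_lt.1 h) hij.symm)
  refine hpot.mono ?_ (Eventually.of_forall (norm_mulPair_le_norm_potentialEnergy hv h Ψ))
  exact (Complex.continuous_ofReal.comp_aestronglyMeasurable
    (hvm.comp_quasiMeasurePreserving (quasiMeasurePreserving_sub hij))).mul hΨ.1

/-- Multiplication by `ω(x_i - x_j)` for continuous `ω`, as a continuous function on `Λ^N`. -/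
def pairC {ω : Torus d ℓ → ℝ} (hω : Continuous ω) (i j : Fin N) : C(Fin N → Torus d ℓ, ℂ) :=
  ⟨fun x => (ω (x i - x j) : ℂ), Complex.continuous_ofReal.comp
    (hω.comp ((continuous_apply i).sub (continuous_apply j)))⟩

lemma Represents.mulPair {ω : Torus d ℓ → ℝ} (hω : Continuous ω) {Ψ : WaveFn d ℓ N}
    {ψ : ConfigL2 d ℓ N} (h : Represents Ψ ψ) (i j : Fin N) :
    Represents (mulPair ω i j Ψ) (DiluteBose.mulC (pairC hω i j) ψ) :=
  h.mulC (pairC hω i j)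

lemma represents_mulPair_projP {g : Torus d ℓ → ℝ} {gE : OneL2 d ℓ}
    (hg : (fun x => (g x : ℂ)) =ᵐ[volume] gE) {i j : Fin N} (hij : i ≠ j)
    {Ψ : WaveFn d ℓ N} {ψ : ConfigL2 d ℓ N} (h : Represents Ψ ψ) :
    Represents (mulPair g i j (projP i Ψ)) (pairOp i j gE ψ) :=
  represents_pairOp hij hg (h.projP i)

lemma projQ_projQ_eq (i j : Fin N) (Ψ : WaveFn d ℓ N) :
    projQ j (projQ i Ψ) = Ψ - projP i Ψ - projP j (projQ i Ψ) := rfl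

lemma projPair_eq (i j : Fin N) (Ψ : WaveFn d ℓ N) :
    projPair j i Ψ = projP i Ψ + projP j (projQ i Ψ) := by
  have h : projQ j (projP i Ψ) = projP i Ψ - projP j (projP i Ψ) := rfl
  rw [projPair, h]
  abel

variable {v g ω : Torus d ℓ → ℝ}

/-- `v (Q_jQ_i + ω (1 - Q_jQ_i)) Ψ = v Ψ - g (1 - Q_jQ_i) Ψ`. -/
lemma represents_dressed (hg : ∀ x, g x = v x * (1 - ω x)) (hge : IsEven g) {gE : OneL2 d ℓ}
    (hgE : (fun x => (g x : ℂ)) =ᵐ[volume] gE) {i j : Fin N} (hij : i ≠ j)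
    {Ψ : WaveFn d ℓ N} {ψ w : ConfigL2 d ℓ N} (hψ : Represents Ψ ψ)
    (hw : Represents (mulPair v i j Ψ) w) :
    Represents (mulPair v i j (projQ j (projQ i Ψ) + mulPair ω i j (projPair j i Ψ)))
      (w - (pairOp i j gE ψ + pairOp j i gE (opQ i ψ))) := by
  have h1 : mulPair v i j (projQ j (projQ i Ψ) + mulPair ω i j (projPair j i Ψ)) =
      mulPair v i j Ψ - (mulPair g i j (projP i Ψ) + mulPair g j i (projP j (projQ i Ψ))) := by
    rw [mulPair_swap hge j i, projPair_eq, projQ_projQ_eq]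
    funext x
    simp only [mulPair, Pi.sub_apply, Pi.add_apply, hg]
    push_cast
    ring
  rw [h1]
  exact hw.sub ((represents_mulPair_projP hgE hij hψ).add
    (represents_mulPair_projP hgE hij.symm (hψ.projQ i)))

/-- The vector `g Q_jQ_i Ψ`. -/
lemma represents_excited (hω : Continuous ω) (hg : ∀ x, g x = v x * (1 - ω x)) (hge : IsEven g)
    {gE : OneL2 d ℓ} (hgE : (fun x => (g x : ℂ)) =ᵐ[volume] gE) {i j : Fin N} (hij : i ≠ j)
    {Ψ : WaveFn d ℓ N} {ψ w : ConfigL2 d ℓ N} (hψ : Represents Ψ ψ)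
    (hw : Represents (mulPair v i j Ψ) w) :
    Represents (mulPair g i j (projQ j (projQ i Ψ)))
      (w - mulC (pairC hω i j) w - (pairOp i j gE ψ + pairOp j i gE (opQ i ψ))) := by
  have h1 : mulPair g i j (projQ j (projQ i Ψ)) = mulPair v i j Ψ - mulPair ω i j (mulPair v i j Ψ) -
      (mulPair g i j (projP i Ψ) + mulPair g j i (projP j (projQ i Ψ))) := by
    rw [mulPair_swap hge j i, projQ_projQ_eq]
    funext x
    simp only [mulPair, Pi.sub_apply, Pi.add_apply, hg]
    push_cast
    ring
  rw [h1]
  exact (hw.sub (hw.mulPair hω i j)).sub ((represents_mulPair_projP hgE hij hψ).add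
    (represents_mulPair_projP hgE hij.symm (hψ.projQ i)))

/-- This factors gω P_i as Ω(g P_i), the form in which `pair_decomposition` receives g + gω. -/
lemma pairOp_mul_continuous (hω : Continuous ω) {gE hE : OneL2 d ℓ}
    (hgE : (fun x => (g x : ℂ)) =ᵐ[volume] gE)
    (hhE : (fun x => ((g * ω) x : ℂ)) =ᵐ[volume] hE) {i j : Fin N} (hij : i ≠ j)
    (x : ConfigL2 d ℓ N) : pairOp i j hE x = mulC (pairC hω i j) (pairOp i j gE x) := by
  have h1 := represents_pairOp hij hhE (represents_coe (opP i x))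
  have h2 := (represents_pairOp hij hgE (represents_coe (opP i x))).mulC (pairC hω i j)
  refine h1.eq_of_ae h2 (Eventually.of_forall fun y => ?_)
  simp only [pairC, ContinuousMap.coe_mk, Pi.mul_apply]
  push_cast
  ring

omit hℓ in
lemma pairC_swap (hω : Continuous ω) (hωe : IsEven ω) (i j : Fin N) :
    pairC hω i j = pairC hω j i := by
  ext x
  simp only [pairC, ContinuousMap.coe_mk]
  rw [← hωe (x i - x j), neg_sub]

lemma represents_pairTerm {Ψ : WaveFn d ℓ N} (hΨ : IsBosonic Ψ) {ψ : ConfigL2 d ℓ N}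
    (hψ : Represents Ψ ψ) (k : Fin d → ℤ) :
    Represents (onSector (pairTerm g ω k) Ψ)
      ((fourierHat g k + fourierHat (g * ω) k) •
          (pairSum fun i j => opT i 0 k (opT j k 0 ψ)) +
        (1 / 2 * fourierHat g k) •
          ((pairSum fun i j => opT i 0 k (opT j 0 (-k) ψ)) +
            pairSum fun i j => opT i (-k) 0 (opT j k 0 ψ))) :=
  ((represents_cre_cre_ann_ann hΨ hψ 0 k k 0).smul _).add
    (((represents_cre_cre_ann_ann hΨ hψ 0 0 k (-k)).add
      (represents_cre_cre_ann_ann hΨ hψ (-k) k 0 0)).smul _)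

/-- The expansion rests on v ≥ 0, v ∈ L², evenness, continuity of ω and the relation g = v(1 - ω).
-/
theorem hamiltonian_expansion (hv0 : ∀ x, 0 ≤ v x) (hve : IsEven v) (hv2 : MemLp v 2 volume)
    (hω : Continuous ω) (hωe : IsEven ω) (hg : ∀ x, g x = v x * (1 - ω x))
    (Ψ Φ : WaveFn d ℓ N) (hΨ : HamiltonianGraph v Ψ Φ) :
    ∃ K S : WaveFn d ℓ N,
      HasSumL2 (fun k : Fin d → ℤ => onSector (kineticTerm k) Ψ) K ∧
      HasSumL2 (fun k : {k : Fin d → ℤ // k ≠ 0} => onSector (pairTerm g ω k) Ψ) S ∧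
      MemLp (onSector condensateTerm Ψ) 2 volume ∧
      MemLp (numZero (numPlus Ψ)) 2 volume ∧
      MemLp (Q3ren g Ψ) 2 volume ∧
      MemLp (Q4ren v ω Ψ) 2 volume ∧
      Φ =ᵐ[volume]
        K
        + (1 / (2 * (ℓ : ℂ) ^ d) * (fourierHat g 0 + fourierHat (g * ω) 0)) •
            onSector condensateTerm Ψ
        + (1 / (ℓ : ℂ) ^ d) • S
        + ((fourierHat g 0 + fourierHat (g * ω) 0) / (ℓ : ℂ) ^ d) • numZero (numPlus Ψ)
        + Q3ren g Ψ + Q4ren v ω Ψ := by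
  obtain ⟨hbos, hpot, T, hT2, hT, hΦ⟩ := hΨ
  have hge : IsEven g := fun x => by rw [hg, hg, hve, hωe]
  have hvC : MemLp (fun x => (v x : ℂ)) 2 volume := hv2.ofReal
  have hgC : MemLp (fun x => (g x : ℂ)) 2 volume := by
    refine (memLp_congr_ae (Eventually.of_forall fun x => ?_)).1 (memLp_continuous_mul
      ⟨fun x => ((1 - ω x : ℝ) : ℂ), Complex.continuous_ofReal.comp (continuous_const.sub hω)⟩ hvC)
    simp only [ContinuousMap.coe_mk, hg]
    push_cast
    ring
  have hhC : MemLp (fun x => ((g * ω) x : ℂ)) 2 volume := by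
    refine (memLp_congr_ae (Eventually.of_forall fun x => ?_)).1 (memLp_continuous_mul
      ⟨fun x => (ω x : ℂ), Complex.continuous_ofReal.comp hω⟩ hgC)
    simp only [ContinuousMap.coe_mk, Pi.mul_apply]
    push_cast
    ring
  set ψ : ConfigL2 d ℓ N := hbos.1.toLp
  have hψ : Represents Ψ ψ := Represents.of_memLp hbos.1
  set τ : ConfigL2 d ℓ N := hT2.toLp
  have hτ : Represents T τ := Represents.of_memLp hT2
  set gE : OneL2 d ℓ := hgC.toLp
  have hgE : (fun x => (g x : ℂ)) =ᵐ[volume] gE := hgC.coeFn_toLp.symm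
  set hE : OneL2 d ℓ := hhC.toLp
  have hhE : (fun x => ((g * ω) x : ℂ)) =ᵐ[volume] hE := hhC.coeFn_toLp.symm
  have hfhat : ∀ k, oneHat (gE + hE) k = fourierHat g k + fourierHat (g * ω) k := fun k => by
    rw [← oneHat_eq_fourierHat hgE, ← oneHat_eq_fourierHat hhE]
    exact inner_add_right _ _ _
  -- The vectors vΨ, with a default value 0 at i = j; sums run over distinct indices only.
  have hWex : ∀ i j : Fin N, ∃ w : ConfigL2 d ℓ N, i ≠ j → Represents (mulPair v i j Ψ) w := by
    intro i j
    by_cases hij : i = j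
    · exact ⟨0, fun h => absurd hij h⟩
    · exact ⟨_, fun _ => Represents.of_memLp (memLp_mulPair hv0 hve hv2.1 hbos.1 hpot hij)⟩
  choose w hw using hWex
  have hwsymm : ∀ i j, i ≠ j → w i j = w j i := fun i j hij =>
    (hw i j hij).eq_of_ae (hw j i hij.symm) (EventuallyEq.of_eq (mulPair_swap hve i j Ψ))
  set θ : Fin N → Fin N → ConfigL2 d ℓ N := fun i j =>
    w i j - (pairOp i j gE ψ + pairOp j i gE (opQ i ψ)) with hθ
  set z : Fin N → Fin N → ConfigL2 d ℓ N := fun i j =>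
    w i j - mulC (pairC hω i j) (w i j) - (pairOp i j gE ψ + pairOp j i gE (opQ i ψ)) with hz
  have hzrep : ∀ i j, i ≠ j → Represents (mulPair g i j (projQ j (projQ i Ψ))) (z i j) :=
    fun i j hij => represents_excited hω hg hge hgE hij hψ (hw i j hij)
  have hgswap : ∀ i j, i ≠ j → ∀ x : ConfigL2 d ℓ N,
      pairOp i j gE (opP j x) = pairOp j i gE (opP i x) :=
    fun i j hij x => pairOp_opP_swap hij hge hgE x
  have hhswap : ∀ i j, i ≠ j → ∀ x : ConfigL2 d ℓ N,
      pairOp i j hE (opP j x) = pairOp j i hE (opP i x) :=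
    fun i j hij x => pairOp_opP_swap hij
      (fun x => by rw [Pi.mul_apply, Pi.mul_apply, hge, hωe]) hhE x
  -- The asymmetric splitting Π = P_i + P_jQ_i equals P_i + P_j - P_iP_j after expansion, and the
  -- last term is symmetric by `hgswap`.
  have hzsymm : ∀ i j, i ≠ j → z i j = z j i := fun i j hij => by
    simp only [hz, hwsymm i j hij, pairC_swap hω hωe i j, opQ_apply, map_sub, hgswap i j hij]
    abel
  have hzann : ∀ i j, i ≠ j → opP i (z i j) =
      ContinuousLinearMap.adjoint (pairOp i j gE) (opQ j (opQ i ψ)) := fun i j hij => by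
    refine opP_eq_adjoint_pairOp hij hgE ((hzrep i j hij).congr ?_)
    filter_upwards [(hψ.projQ i).projQ j] with x hx
    simp only [mulPair, hx]
  have hQ3 : Represents (Q3ren g Ψ) (pairSum fun i j =>
      opP i (opQ j (z i j)) + opQ i (opQ j (pairOp i j gE (opQ j ψ)))) := by
    refine Represents.sum _ fun i _ => Represents.sum _ fun j hj => ?_
    have hij : i ≠ j := (Finset.mem_filter.1 hj).2
    refine (((hzrep i j hij).projQ j).projP i).add (((represents_pairOp hij hgE ?_).projQ j).projQ i)
    have h := (hψ.projP i).projQ j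
    rwa [opQ_apply, opP_opP_comm, ← map_sub, ← opQ_apply] at h
  have hQ4 : Represents (Q4ren v ω Ψ) ((1 / 2 : ℂ) • pairSum fun i j =>
      opQ i (opQ j (θ i j)) + (opP i (opP j (mulC (pairC hω i j) (θ i j))) +
        opP i (opQ j (mulC (pairC hω i j) (θ i j))) +
        opQ i (opP j (mulC (pairC hω i j) (θ i j))))) := by
    refine (Represents.sum _ fun i _ => Represents.sum _ fun j hj => ?_).smul _
    have hij : i ≠ j := (Finset.mem_filter.1 hj).2
    have hΘ := represents_dressed hg hge hgE hij hψ (hw i j hij)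
    have hΩ := hΘ.mulPair hω i j
    exact ((hΘ.projQ j).projQ i).add ((((hΩ.projP j).projP i).add ((hΩ.projQ j).projP i)).add
      ((hΩ.projP j).projQ i))
  have hcond : Represents (onSector condensateTerm Ψ) (pairSum fun i j => opP i (opP j ψ)) := by
    have h := represents_cre_cre_ann_ann hbos hψ 0 0 0 0
    simp only [opT_zero_zero] at h
    exact h
  have hnum : Represents (numZero (numPlus Ψ)) (pairSum fun i j => opP i (opQ j ψ)) := by
    have h : Represents (numZero (numPlus Ψ)) (∑ i, opP i (∑ j, opQ j ψ)) :=
      Represents.sum _ fun i _ => (Represents.sum _ fun j _ => hψ.projQ j).projP i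
    convert! h using 1
    refine Finset.sum_congr rfl fun i _ => ?_
    rw [map_sum, Finset.sum_filter]
    refine Finset.sum_congr rfl fun j _ => ?_
    -- P_iQ_i = 0 removes the diagonal from n_0 n_+, leaving the sum over i ≠ j.
    split_ifs with hij
    · rfl
    · rw [not_not] at hij
      rw [← hij, opQ_apply, map_sub, opP_opP, sub_self]
  set V : ℂ := ((ℓ ^ d : ℝ) : ℂ) with hV
  have hVℓ : (ℓ : ℂ) ^ d = V := by rw [hV]; push_cast; rfl
  have hV0 : V ≠ 0 := volume_ne_zero
  set sE := pairSum fun i j => opP i (pairOp j i (gE + hE) (opQ i ψ)) with hsE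
  set sB := pairSum fun i j => opP j (opP i (z i j)) with hsB
  set sC := pairSum fun i j => opQ i (opQ j (pairOp j i gE (opP i ψ))) with hsC
  have hconj : ∀ k, starRingEnd ℂ (oneHat gE k) = oneHat gE k := fun k => by
    rw [oneHat_eq_fourierHat hgE, conj_fourierHat_of_isEven hge]
  have hsum1 : HasSum (fun k : {k : Fin d → ℤ // k ≠ 0} => oneHat (gE + hE) k •
      pairSum fun i j => opT i 0 k (opT j k 0 ψ)) (V • sE) := by
    simp only [hsE, ← pairSum_smul]
    exact HasSum.pairSum fun i j hij => hasSum_exchange hij _ ψ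
  have hsum2 : HasSum (fun k : {k : Fin d → ℤ // k ≠ 0} => oneHat gE k •
      pairSum fun i j => opT i 0 k (opT j 0 (-(k : Fin d → ℤ)) ψ)) (V • sB) := by
    have h : sB = pairSum fun i j =>
        opP j (ContinuousLinearMap.adjoint (pairOp i j gE) (opQ j (opQ i ψ))) :=
      pairSum_congr fun i j hij => by rw [hzann i j hij]
    simp only [h, ← pairSum_smul]
    exact HasSum.pairSum fun i j hij => hasSum_annihilate_pair hij hconj ψ
  have hsum3 : HasSum (fun k : {k : Fin d → ℤ // k ≠ 0} => oneHat gE k •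
      pairSum fun i j => opT i (-(k : Fin d → ℤ)) 0 (opT j k 0 ψ)) (V • sC) := by
    simp only [hsC, ← pairSum_smul]
    exact HasSum.pairSum fun i j hij => hasSum_create_pair hij _ ψ
  have hsum := hsum1.add ((hsum2.add hsum3).const_smul (1 / 2 : ℂ))
  refine ⟨τ, (V • sE + (1 / 2 : ℂ) • (V • sB + V • sC) : ConfigL2 d ℓ N), ?_, ?_, hcond.memLp,
    hnum.memLp, hQ3.memLp, hQ4.memLp, ?_⟩
  · exact hasSumL2_of_hasSum (fun k => (represents_cre_ann hbos hψ k).smul _) (represents_coe τ)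
      (hasSum_kinetic fun p => inner_configE_kinetic hT hψ hτ p)
  · refine hasSumL2_of_hasSum (fun k => represents_pairTerm hbos hψ k) (represents_coe _) ?_
    convert! hsum using 2 with k
    rw [hfhat, oneHat_eq_fourierHat hgE]
    module
  · have hpotrep : Represents (potentialEnergy v Ψ)
        (∑ i, ∑ j ∈ Finset.univ.filter (fun j => i < j), w i j) :=
      Represents.sum _ fun i _ => Represents.sum _ fun j hj =>
        hw i j (Finset.mem_filter.1 hj).2.ne
    have hleft : Represents Φ (τ + ∑ i, ∑ j ∈ Finset.univ.filter (fun j => i < j), w i j) :=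
      (hτ.add hpotrep).congr hΦ
    refine hleft.ae_eq ((((((represents_coe τ).add (hcond.smul _)).add
      ((represents_coe _).smul _)).add (hnum.smul _)).add hQ3).add hQ4) ?_
    have hhalf := pairSum_eq_add_of_symm hwsymm
    have hdec : pairSum w = _ := pairSum_congr fun i j hij =>
      pair_decomposition hij (g := gE) (f := gE + hE) (z := z i j) (θ := θ i j)
        (c := oneHat (gE + hE) 0 / V)
        (Ω := mulC (pairC hω i j)) (ψ := ψ)
        (fun x => by
          simp only [map_add, add_apply]
          rw [hgswap i j hij, hhswap i j hij]) rfl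
        (fun x => by
          simp only [map_add, add_apply]
          rw [pairOp_mul_continuous hω hgE hhE hij])
        (fun x => by
          simp only [map_add, add_apply]
          rw [pairOp_mul_continuous hω hgE hhE hij.symm, pairC_swap hω hωe])
        rfl rfl
    -- Relabelling i ↔ j identifies the mirrored terms, so 𝒬₃, n_0 n_+ and the exchange term each
    -- occur twice, compensating the factor ½. The condensate, pair creation and pair annihilation
    -- terms occur once and keep it.
    have e1 : (pairSum fun i j => opP j (opQ i (z i j))) = pairSum fun i j => opP i (opQ j (z i j)) := by
      rw [pairSum_swap]
      exact pairSum_congr fun i j hij => by rw [hzsymm i j hij]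
    have e2 : (pairSum fun i j => opQ j (opQ i (pairOp j i gE (opQ i ψ)))) =
        pairSum fun i j => opQ i (opQ j (pairOp i j gE (opQ j ψ))) := pairSum_swap _
    have e3 : (pairSum fun i j : Fin N => opP j (opQ i ψ)) = pairSum fun i j => opP i (opQ j ψ) :=
      pairSum_swap _
    have e4 : (pairSum fun i j => opP j (pairOp i j (gE + hE) (opQ j ψ))) = sE := pairSum_swap _
    have e5 : (pairSum fun i j => opQ i (opQ j (pairOp i j gE (opP j ψ)))) = sC :=
      pairSum_congr fun i j hij => by rw [hgswap i j hij]
    simp only [pairSum_add, pairSum_smul, e1, e2, e3, e4, e5, ← hsB, ← hsE] at hdec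
    have hc : fourierHat g 0 + fourierHat (g * ω) 0 = (oneHat (gE + hE) 0 / V) * V := by
      rw [hfhat, div_mul_cancel₀ _ hV0]
    have hhalf' : ∑ i, ∑ j ∈ Finset.univ.filter (fun j => i < j), w i j =
        (1 / 2 : ℂ) • pairSum w := by
      rw [hhalf]
      module
    rw [hhalf', hdec, hVℓ, hc]
    generalize oneHat (gE + hE) 0 / V = c
    have c1 : 1 / (2 * V) * (c * V) = c / 2 := by field_simp
    have c2 : c * V / V = c := by field_simp
    have c3 : ∀ x : ConfigL2 d ℓ N, (1 / V) • V • x = x := fun x => by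
      rw [smul_smul, one_div, inv_mul_cancel₀ hV0, one_smul]
    simp only [c1, c2, pairSum_add, smul_add, c3, smul_comm (1 / V) (1 / 2 : ℂ)]
    module

end Hamiltonian

/-! ### Radial profiles on the torus -/

section Profiles

variable {d : ℕ} {ℓ : ℝ}

lemma torusNorm_nonneg (x : Torus d ℓ) : 0 ≤ torusNorm x := Real.sqrt_nonneg _

lemma continuous_torusNorm : Continuous (torusNorm : Torus d ℓ → ℝ) :=
  Real.continuous_sqrt.comp
    (continuous_finsetSum _ fun α _ => ((continuous_apply α).norm).pow 2)

lemma isEven_periodize (f : ℝ → ℝ) : IsEven (periodize d ℓ f) := fun x => by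
  simp only [periodize, torusNorm, Pi.neg_apply, norm_neg]

/-- Continuity is given for the radial function on ℝ^d; composing it with a ray in a coordinate
direction, which needs d ≠ 0, yields continuity in the torus distance. -/
lemma continuous_periodize_omegaProfile (hd : d ≠ 0) (δ : ℝ) {φ₀ : ℝ → ℝ}
    (hφ : Continuous fun x : EuclideanSpace ℝ (Fin d) => φ₀ ‖x‖) :
    Continuous (periodize d ℓ (omegaProfile d δ φ₀)) := by
  have h1 : Continuous fun x : Torus d ℓ => φ₀ (torusNorm x) := by
    have h2 : Continuous fun x : Torus d ℓ =>
        (torusNorm x) • (EuclideanSpace.single ⟨0, Nat.pos_of_ne_zero hd⟩ (1 : ℝ) :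
          EuclideanSpace ℝ (Fin d)) := continuous_torusNorm.smul continuous_const
    refine (hφ.comp h2).congr fun x => ?_
    simp [norm_smul, abs_of_nonneg (torusNorm_nonneg x)]
  unfold periodize omegaProfile scatteringNormalized
  split_ifs
  · exact continuous_const.sub (continuous_const.mul h1)
  · exact continuous_const.sub h1

end Profiles

end DiluteBose

end

/-! ### The expansion for the scattering data -/

open DiluteBose in
theorem mainTheorem9 (d : ℕ) (hd : d = 2 ∨ d = 3) (ℓ R a δ : ℝ) [Fact (0 < ℓ)]
    (hR : 0 < R) (hRℓ : R ≤ ℓ / 4)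
    (V : ℝ → ℝ) (hVmeas : Measurable V) (hVnonneg : ∀ r, 0 ≤ r → 0 ≤ V r)
    (hVsupp : ∀ r, R < r → V r = 0) (hVL2 : MemLp (periodize d ℓ V) 2 volume)
    (ha : IsScatteringLength d V R a)
    (hδ : d = 2 → 0 < δ ∧ R < a * Real.exp (1 / (2 * δ)))
    (φ₀ : ℝ → ℝ) (hφ₀ : IsScatteringSolution d V R a φ₀)
    (v g ω : Torus d ℓ → ℝ)
    (hv : v = periodize d ℓ V) (hω : ω = periodize d ℓ (omegaProfile d δ φ₀))
    (hg : g = periodize d ℓ (gProfile d V δ φ₀))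
    (N : ℕ) (Ψ Φ : WaveFn d ℓ N) (hΨ : HamiltonianGraph v Ψ Φ) :
    ∃ K S : WaveFn d ℓ N,
      HasSumL2 (fun k : Fin d → ℤ => onSector (kineticTerm k) Ψ) K ∧
      HasSumL2 (fun k : {k : Fin d → ℤ // k ≠ 0} => onSector (pairTerm g ω k) Ψ) S ∧
      MemLp (onSector condensateTerm Ψ) 2 volume ∧
      MemLp (numZero (numPlus Ψ)) 2 volume ∧
      MemLp (Q3ren g Ψ) 2 volume ∧
      MemLp (Q4ren v ω Ψ) 2 volume ∧
      Φ =ᵐ[volume]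
        K
        + (1 / (2 * (ℓ : ℂ) ^ d) * (fourierHat g 0 + fourierHat (g * ω) 0)) •
            onSector condensateTerm Ψ
        + (1 / (ℓ : ℂ) ^ d) • S
        + ((fourierHat g 0 + fourierHat (g * ω) 0) / (ℓ : ℂ) ^ d) • numZero (numPlus Ψ)
        + Q3ren g Ψ + Q4ren v ω Ψ := by
  subst hv hω hg
  have hd0 : d ≠ 0 := by omega
  exact hamiltonian_expansion (fun x => hVnonneg _ (torusNorm_nonneg x)) (isEven_periodize V) hVL2
    (continuous_periodize_omegaProfile hd0 δ hφ₀.continuous) (isEven_periodize _) (fun _ => rfl)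
    Ψ Φ hΨ
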